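/- Let $K\subset\mathbb R^3$ be a knot (a smoothly embedded circle) and let $V$ be a $2n\times 2n$ Seifert matrix of $K$, i.e. $V_{ij}=\operatorname{lk}(v_i,v_j^+)$ for simple closed curves $v_1,\dots,v_{2n}$ on a Seifert surface $F$ of $K$ that represent a basis of $H_1(F;\mathbb Z)$, where $v_j^+$ is the positive push-off of $v_j$. Let $\sigma(K)=\operatorname{sign}(V+V^t)$ be the signature of $K$ and let $\det(K)=(-1)^n\det(V+V^t)$ be its signed determinant. Let $\Sigma(K)$ be the two-fold branched cover of $K$, with $$H_1(\Sigma(K);\mathbb Z)=\mathbb Z^{2n}/(V+V^t)\mathbb Z^{2n},$$ and let $l$ be its linking pairing $l(v,w)=v^t(V+V^t)^{-1}w\in\mathbb Q/\mathbb Z$. Let $W(\mathbb Q)$ be the Witt group of non-singular symmetric bilinear forms over $\mathbb Q$ (forms modulo metabolic forms), and let $\varphi(K)\in W(\mathbb Q)$ be the class of $V+V^t$. Let $\epsilon\in\{1,-1\}$. Suppose that $\sigma(K)\in\{0,2\epsilon\}$ and that there is a generator $h$ of $H_1(\Sigma(K);\mathbb Z)$ with $$l(h,h)=\frac{-2\epsilon}{\det(K)}\in\mathbb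 Q/\mathbb Z .$$ Then $\varphi(K)$ is represented by the diagonal matrix with entries $2\epsilon$ and $-2\epsilon\det(K)$. -/

import Mathlib

open scoped Topology ContDiff Matrix
open Filter Matrix

/-! ## Knots, Seifert surfaces and Seifert matrices -/

noncomputable section

/-- Three-dimensional Euclidean space. -/
abbrev Space : Type := EuclideanSpace ℝ (Fin 3)

/-- A smoothly embedded closed curve in Euclidean 3-space: a smooth embedding of the circle `ℝ/ℤ`. -/
structure SimpleClosedCurve where
  toFun : UnitAddCircle → Space
  smooth : ContDiff ℝ ∞ (fun t : ℝ => toFun (t : UnitAddCircle))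
  regular : ∀ t : ℝ, deriv (fun t : ℝ => toFun (t : UnitAddCircle)) t ≠ 0
  injective : Function.Injective toFun

/-- A knot is a smoothly embedded circle in 3-space. -/
abbrev Knot : Type := SimpleClosedCurve

theorem SimpleClosedCurve.continuous (c : SimpleClosedCurve) : Continuous c.toFun :=
  continuous_coinduced_dom.mpr c.smooth.continuous

/-- The smooth `1`-periodic parametrization `ℝ → ℝ³` of a closed curve. -/
def SimpleClosedCurve.lift (c : SimpleClosedCurve) : ℝ → Space :=
  fun t => c.toFun (t : UnitAddCircle)

/-- Gauss' integral for the linking number of two disjoint closed curves, given by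
`1`-periodic parametrizations:
`lk(a, b) = (1/4π) ∫∫ det (a'(s), b'(t), a(s) - b(t)) / |a(s) - b(t)|³ dt ds`. -/
def linkingNumber (a b : ℝ → Space) : ℝ :=
  1 / (4 * Real.pi) * ∫ s in (0 : ℝ)..1, ∫ t in (0 : ℝ)..1,
    (Matrix.of ![(deriv a s).ofLp, (deriv b t).ofLp, (a s - b t).ofLp]).det / ‖a s - b t‖ ^ 3

/-- `F`, together with the unit normal field `ν`, is a Seifert surface of `K`: a compact connected
smooth surface in 3-space, oriented by `ν`, whose boundary is (the image of) `K`.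
Away from `K` the surface is locally a regular level set `{f = 0}`, and near a point of `K` it is
locally a half surface `{f = 0, g ≥ 0}` whose edge `{f = 0, g = 0}` is `K`.
Either of the two orientations of the surface is allowed. -/
structure IsSeifertSurface (K : Knot) (F : Set Space) (ν : Space → Space) : Prop where
  isCompact : IsCompact F
  isConnected : IsConnected F
  boundary_subset : Set.range K.toFun ⊆ F
  interior_chart : ∀ p ∈ F, p ∉ Set.range K.toFun →
    ∃ U ∈ 𝓝 p, ∃ f : Space → ℝ, ContDiff ℝ ∞ f ∧ fderiv ℝ f p ≠ 0 ∧
      (∀ x ∈ U, x ∈ F ↔ f x = 0) ∧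
      ∀ w, fderiv ℝ f p w = 0 → inner ℝ (ν p) w = 0
  boundary_chart : ∀ p ∈ Set.range K.toFun,
    ∃ U ∈ 𝓝 p, ∃ f g : Space → ℝ, ContDiff ℝ ∞ f ∧ ContDiff ℝ ∞ g ∧
      LinearIndependent ℝ ![fderiv ℝ f p, fderiv ℝ g p] ∧
      (∀ x ∈ U, x ∈ F ↔ f x = 0 ∧ 0 ≤ g x) ∧
      (∀ x ∈ U, x ∈ Set.range K.toFun ↔ f x = 0 ∧ g x = 0) ∧
      ∀ w, fderiv ℝ f p w = 0 → inner ℝ (ν p) w = 0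
  normal_smooth : ContDiff ℝ ∞ ν
  normal_unit : ∀ p ∈ F, ‖ν p‖ = 1

/-- The first singular homology group with integer coefficients, as a functor. -/
abbrev HOne : CategoryTheory.Functor TopCat.{0} (ModuleCat.{0} ℤ) :=
  (AlgebraicTopology.singularHomologyFunctor (ModuleCat.{0} ℤ) 1).obj (ModuleCat.of ℤ ℤ)

/-- A closed curve on `F`, as a map from the circle to `F`. -/
def SimpleClosedCurve.toMap (c : SimpleClosedCurve) {F : Set Space} (hc : ∀ s, c.toFun s ∈ F) :
    TopCat.of UnitAddCircle ⟶ TopCat.of F :=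
  TopCat.ofHom ⟨fun s => ⟨c.toFun s, hc s⟩, c.continuous.subtype_mk hc⟩

/-- The closed curves `v i` on `F` represent a basis of `H₁(F; ℤ)`: as `H₁(ℝ/ℤ; ℤ)` is infinite
cyclic, generated by the class of the circle, this says that the `v i` together induce an
isomorphism `⨁ᵢ H₁(ℝ/ℤ; ℤ) → H₁(F; ℤ)`. -/
def RepresentsBasis {m : ℕ} {F : Set Space} (v : Fin m → SimpleClosedCurve)
    (hv : ∀ i s, (v i).toFun s ∈ F) : Prop :=
  Function.Bijective fun x : Fin m → HOne.obj (TopCat.of UnitAddCircle) =>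
    ∑ i, (HOne.map ((v i).toMap (hv i))).hom (x i)

/-- `V` is a Seifert matrix of `K`: there are a Seifert surface `F` of `K` and simple closed curves
`v i` on `F` representing a basis of `H₁(F; ℤ)` such that `V i j = lk(v i, (v j)⁺)`, where `(v j)⁺`
is obtained by pushing `v j` off `F` by a small distance in the positive normal direction. -/
def IsSeifertMatrix (K : Knot) {m : ℕ} (V : Matrix (Fin m) (Fin m) ℤ) : Prop :=
  ∃ (F : Set Space) (ν : Space → Space), IsSeifertSurface K F ν ∧
  ∃ (v : Fin m → SimpleClosedCurve) (hv : ∀ i s, (v i).toFun s ∈ F), RepresentsBasis v hv ∧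
    ∀ i j, ∀ᶠ δ in 𝓝[>] (0 : ℝ),
      linkingNumber (v i).lift (fun t => (v j).lift t + δ • ν ((v j).lift t)) = V i j

/-! ## Invariants computed from a Seifert matrix -/

/-- The signature of a symmetric integral matrix: the number of positive minus the number of
negative squares of the associated real quadratic form. -/
def matrixSignature {m : ℕ} (A : Matrix (Fin m) (Fin m) ℤ) : ℤ :=
  (sigPos (A.map (Int.cast : ℤ → ℝ)).toQuadraticForm' : ℤ) -
    (sigNeg (A.map (Int.cast : ℤ → ℝ)).toQuadraticForm' : ℤ)

/-- The signature `σ(K) = sign (V + Vᵗ)` of a knot with Seifert matrix `V`. -/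
def knotSignature {n : ℕ} (V : Matrix (Fin (2 * n)) (Fin (2 * n)) ℤ) : ℤ :=
  matrixSignature (V + Vᵀ)

/-- The signed determinant `det K = (-1)ⁿ det (V + Vᵗ)` of a knot with `2n × 2n` Seifert
matrix `V`. -/
def knotDet {n : ℕ} (V : Matrix (Fin (2 * n)) (Fin (2 * n)) ℤ) : ℤ :=
  (-1) ^ n * (V + Vᵀ).det

/-- The first homology group `H₁(Σ(K); ℤ) = ℤ²ⁿ / (V + Vᵗ) ℤ²ⁿ` of the two-fold branched cover of
a knot with Seifert matrix `V`. -/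
abbrev BranchedCoverHomology {m : ℕ} (V : Matrix (Fin m) (Fin m) ℤ) : Type :=
  (Fin m → ℤ) ⧸ LinearMap.range (V + Vᵀ).mulVecLin

/-- The rational symmetric matrix `V + Vᵗ`. -/
def symmetrization {m : ℕ} (V : Matrix (Fin m) (Fin m) ℤ) : Matrix (Fin m) (Fin m) ℚ :=
  (V + Vᵀ).map (Int.cast : ℤ → ℚ)

theorem symmetrization_isSymm {m : ℕ} (V : Matrix (Fin m) (Fin m) ℤ) :
    (symmetrization V).IsSymm := by
  ext i j
  simp [symmetrization, add_comm]

/-- The `ℚ/ℤ`-valued pairing `(v, w) ↦ vᵗ (V + Vᵗ)⁻¹ w` on `ℤᵐ`. -/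
def prePairing {m : ℕ} (V : Matrix (Fin m) (Fin m) ℤ) :
    (Fin m → ℤ) →ₗ[ℤ] (Fin m → ℤ) →ₗ[ℤ] AddCircle (1 : ℚ) :=
  LinearMap.mk₂ ℤ
    (fun v w =>
      ((fun i => (v i : ℚ)) ⬝ᵥ (symmetrization V)⁻¹ *ᵥ (fun i => (w i : ℚ)) : ℚ))
    (by
      intro v v' w
      rw [← AddCircle.coe_add, ← add_dotProduct]
      congr 2
      ext i
      simp)
    (by
      intro c v w
      rw [← AddCircle.coe_zsmul, ← smul_dotProduct]
      congr 2
      ext i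
      simp)
    (by
      intro v w w'
      rw [← AddCircle.coe_add, ← dotProduct_add, ← mulVec_add]
      congr 3
      ext i
      simp)
    (by
      intro c v w
      rw [← AddCircle.coe_zsmul, ← dotProduct_smul, ← mulVec_smul]
      congr 3
      ext i
      simp)

theorem prePairing_comm {m : ℕ} (V : Matrix (Fin m) (Fin m) ℤ) (v w : Fin m → ℤ) :
    prePairing V v w = prePairing V w v := by
  simp only [prePairing, LinearMap.mk₂_apply]
  congr 1
  rw [dotProduct_mulVec, dotProduct_comm, ← mulVec_transpose, transpose_nonsing_inv,
    (symmetrization_isSymm V).eq]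

theorem prePairing_mulVec {m : ℕ} (V : Matrix (Fin m) (Fin m) ℤ) (v u : Fin m → ℤ) :
    prePairing V v ((V + Vᵀ) *ᵥ u) = 0 := by
  simp only [prePairing, LinearMap.mk₂_apply]
  set B := symmetrization V with hB
  have h1 : (fun i => (((V + Vᵀ) *ᵥ u) i : ℚ)) = B *ᵥ (fun i => (u i : ℚ)) := by
    ext i
    simp only [hB, symmetrization, mulVec, dotProduct, Matrix.map_apply]
    push_cast
    rfl
  rw [h1, mulVec_mulVec]
  by_cases h : IsUnit B.det
  · rw [nonsing_inv_mul _ h, one_mulVec, AddCircle.coe_eq_zero_iff]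
    refine ⟨v ⬝ᵥ u, ?_⟩
    simp [dotProduct]
  · rw [nonsing_inv_apply_not_isUnit _ h]
    simp

/-- The linking pairing `l(K)` on `H₁(Σ(K); ℤ)`, with values in `ℚ/ℤ`, of a knot with Seifert matrix
`V`: it is induced by `(v, w) ↦ vᵗ (V + Vᵗ)⁻¹ w`. -/
def linkingPairing {m : ℕ} (V : Matrix (Fin m) (Fin m) ℤ) :
    BranchedCoverHomology V →ₗ[ℤ] BranchedCoverHomology V →ₗ[ℤ] AddCircle (1 : ℚ) :=
  (Submodule.liftQ (LinearMap.range (V + Vᵀ).mulVecLin)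
    (Submodule.liftQ (LinearMap.range (V + Vᵀ).mulVecLin) (prePairing V) (by
      rintro _ ⟨u, rfl⟩
      refine LinearMap.mem_ker.mpr (LinearMap.ext fun v => ?_)
      rw [prePairing_comm]
      exact prePairing_mulVec V v u)).flip (by
      rintro _ ⟨u, rfl⟩
      refine LinearMap.mem_ker.mpr (LinearMap.ext fun x => ?_)
      obtain ⟨v, rfl⟩ := Submodule.mkQ_surjective _ x
      exact prePairing_mulVec V v u)).flip

theorem linkingPairing_mk {m : ℕ} (V : Matrix (Fin m) (Fin m) ℤ) (v w : Fin m → ℤ) :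
    linkingPairing V (Submodule.Quotient.mk v) (Submodule.Quotient.mk w) =
      (((fun i => (v i : ℚ)) ⬝ᵥ (symmetrization V)⁻¹ *ᵥ (fun i => (w i : ℚ)) : ℚ) :
        AddCircle (1 : ℚ)) := by
  rfl

/-! ## The Witt group of `ℚ` -/

/-- A non-singular symmetric bilinear form over `ℚ`, given by its Gram matrix. -/
structure RatForm where
  dim : ℕ
  mat : Matrix (Fin dim) (Fin dim) ℚ
  symm : mat.IsSymm
  nonsing : mat.det ≠ 0

/-- Congruence of square matrices: `B = Pᵗ A P` for an invertible `P`. -/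
def MatCongruent {ι κ : Type*} [Fintype ι] [Fintype κ] [DecidableEq ι] [DecidableEq κ]
    (A : Matrix ι ι ℚ) (B : Matrix κ κ ℚ) : Prop :=
  ∃ (P : Matrix ι κ ℚ) (Q : Matrix κ ι ℚ), P * Q = 1 ∧ Q * P = 1 ∧ Pᵀ * A * P = B

/-- A form is metabolic if there is a subspace `L` with `L = L^⊥`. -/
def IsMetabolic {ι : Type*} [Fintype ι] (A : Matrix ι ι ℚ) : Prop :=
  ∃ L : Submodule ℚ (ι → ℚ), ∀ x, x ∈ L ↔ ∀ y ∈ L, x ⬝ᵥ A *ᵥ y = 0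

section Congruence

variable {ι κ μ ι' κ' : Type*} [Fintype ι] [Fintype κ] [Fintype μ] [Fintype ι'] [Fintype κ']
  [DecidableEq ι] [DecidableEq κ] [DecidableEq μ] [DecidableEq ι'] [DecidableEq κ']

set_option linter.unusedSectionVars false

theorem MatCongruent.refl (A : Matrix ι ι ℚ) : MatCongruent A A := ⟨1, 1, by simp, by simp, by simp⟩

theorem MatCongruent.symm {A : Matrix ι ι ℚ} {B : Matrix κ κ ℚ} (h : MatCongruent A B) :
    MatCongruent B A := by
  obtain ⟨P, Q, h1, h2, rfl⟩ := h
  refine ⟨Q, P, h2, h1, ?_⟩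
  have h3 : Qᵀ * Pᵀ = 1 := by rw [← transpose_mul, h1, transpose_one]
  calc Qᵀ * (Pᵀ * A * P) * Q = (Qᵀ * Pᵀ) * A * (P * Q) := by simp only [Matrix.mul_assoc]
    _ = A := by rw [h3, h1]; simp

theorem MatCongruent.trans {A : Matrix ι ι ℚ} {B : Matrix κ κ ℚ} {C : Matrix μ μ ℚ}
    (h : MatCongruent A B) (h' : MatCongruent B C) : MatCongruent A C := by
  obtain ⟨P, Q, h1, h2, rfl⟩ := h
  obtain ⟨P', Q', h1', h2', rfl⟩ := h'
  refine ⟨P * P', Q' * Q, ?_, ?_, ?_⟩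
  · calc P * P' * (Q' * Q) = P * (P' * Q') * Q := by simp only [Matrix.mul_assoc]
      _ = 1 := by rw [h1', Matrix.mul_one, h1]
  · calc Q' * Q * (P * P') = Q' * (Q * P) * P' := by simp only [Matrix.mul_assoc]
      _ = 1 := by rw [h2, Matrix.mul_one, h2']
  · simp only [transpose_mul, Matrix.mul_assoc]

theorem MatCongruent.of_equiv (e : ι ≃ κ) (A : Matrix ι ι ℚ) (B : Matrix κ κ ℚ)
    (h : ∀ i j, A i j = B (e i) (e j)) : MatCongruent A B := by
  refine ⟨(1 : Matrix ι ι ℚ).submatrix id e.symm, (1 : Matrix ι ι ℚ).submatrix e.symm id, ?_, ?_, ?_⟩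
  · rw [submatrix_mul_equiv]; simp
  · rw [← submatrix_mul _ _ _ _ _ Function.bijective_id]; simp
  · ext i j
    simp [Matrix.mul_apply, Matrix.one_apply, h]

theorem MatCongruent.fromBlocks {A : Matrix ι ι ℚ} {B : Matrix κ κ ℚ} {A' : Matrix ι' ι' ℚ}
    {B' : Matrix κ' κ' ℚ} (h : MatCongruent A B) (h' : MatCongruent A' B') :
    MatCongruent (fromBlocks A 0 0 A') (fromBlocks B 0 0 B') := by
  obtain ⟨P, Q, h1, h2, rfl⟩ := h
  obtain ⟨P', Q', h1', h2', rfl⟩ := h'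
  refine ⟨Matrix.fromBlocks P 0 0 P', Matrix.fromBlocks Q 0 0 Q', ?_, ?_, ?_⟩ <;>
    simp [fromBlocks_multiply, fromBlocks_transpose, *]

theorem MatCongruent.neg {A : Matrix ι ι ℚ} {B : Matrix κ κ ℚ} (h : MatCongruent A B) :
    MatCongruent (-A) (-B) := by
  obtain ⟨P, Q, h1, h2, rfl⟩ := h
  exact ⟨P, Q, h1, h2, by simp⟩

theorem IsMetabolic.congr {A : Matrix ι ι ℚ} {B : Matrix κ κ ℚ} (h : MatCongruent A B)
    (hA : IsMetabolic A) : IsMetabolic B := by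
  obtain ⟨P, Q, h1, h2, rfl⟩ := h
  obtain ⟨L, hL⟩ := hA
  refine ⟨L.comap P.mulVecLin, fun x => ?_⟩
  have key : ∀ y, x ⬝ᵥ (Pᵀ * A * P) *ᵥ y = (P *ᵥ x) ⬝ᵥ A *ᵥ (P *ᵥ y) := fun y => by
    rw [← mulVec_mulVec, ← mulVec_mulVec, dotProduct_mulVec, vecMul_transpose]
  simp only [Submodule.mem_comap, mulVecLin_apply, key]
  rw [hL]
  refine ⟨fun H y hy => H _ hy, fun H y hy => ?_⟩
  have := H (Q *ᵥ y)
  rw [mulVec_mulVec, h1, one_mulVec] at this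
  exact this hy

theorem IsMetabolic.neg {A : Matrix ι ι ℚ} (hA : IsMetabolic A) : IsMetabolic (-A) := by
  obtain ⟨L, hL⟩ := hA
  exact ⟨L, fun x => by simpa [neg_mulVec] using hL x⟩

theorem IsMetabolic.fromBlocks {A : Matrix ι ι ℚ} {B : Matrix κ κ ℚ} (hA : IsMetabolic A)
    (hB : IsMetabolic B) : IsMetabolic (fromBlocks A 0 0 B) := by
  obtain ⟨L, hL⟩ := hA
  obtain ⟨M, hM⟩ := hB
  refine ⟨L.comap (LinearMap.funLeft ℚ ℚ Sum.inl) ⊓ M.comap (LinearMap.funLeft ℚ ℚ Sum.inr),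
    fun x => ?_⟩
  have key : ∀ y : ι ⊕ κ → ℚ, x ⬝ᵥ (Matrix.fromBlocks A 0 0 B) *ᵥ y =
      (x ∘ Sum.inl) ⬝ᵥ A *ᵥ (y ∘ Sum.inl) + (x ∘ Sum.inr) ⬝ᵥ B *ᵥ (y ∘ Sum.inr) := fun y => by
    rw [fromBlocks_mulVec, dotProduct_block]
    simp
  have e1 : ∀ y : ι ⊕ κ → ℚ, LinearMap.funLeft ℚ ℚ Sum.inl y = y ∘ Sum.inl := fun _ => rfl
  have e2 : ∀ y : ι ⊕ κ → ℚ, LinearMap.funLeft ℚ ℚ Sum.inr y = y ∘ Sum.inr := fun _ => rfl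
  simp only [Submodule.mem_inf, Submodule.mem_comap, key, e1, e2]
  constructor
  · rintro ⟨h1, h2⟩ y ⟨h3, h4⟩
    rw [(hL _).mp h1 _ h3, (hM _).mp h2 _ h4, add_zero]
  · intro H
    refine ⟨(hL _).mpr fun y hy => ?_, (hM _).mpr fun y hy => ?_⟩
    · have := H (Sum.elim y 0)
      simp only [Sum.elim_comp_inl, Sum.elim_comp_inr] at this
      simpa using this ⟨hy, M.zero_mem⟩
    · have := H (Sum.elim 0 y)
      simp only [Sum.elim_comp_inl, Sum.elim_comp_inr] at this
      simpa using this ⟨L.zero_mem, hy⟩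

theorem isMetabolic_fromBlocks_neg {A : Matrix ι ι ℚ} (hA : A.det ≠ 0) :
    IsMetabolic (fromBlocks A 0 0 (-A)) := by
  refine ⟨LinearMap.eqLocus (LinearMap.funLeft ℚ ℚ Sum.inl) (LinearMap.funLeft ℚ ℚ Sum.inr),
    fun x => ?_⟩
  have key : ∀ y : ι ⊕ ι → ℚ, x ⬝ᵥ (Matrix.fromBlocks A 0 0 (-A)) *ᵥ y =
      (x ∘ Sum.inl) ⬝ᵥ A *ᵥ (y ∘ Sum.inl) - (x ∘ Sum.inr) ⬝ᵥ A *ᵥ (y ∘ Sum.inr) := fun y => by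
    rw [fromBlocks_mulVec, dotProduct_block]
    simp [neg_mulVec, sub_eq_add_neg]
  have e1 : ∀ y : ι ⊕ ι → ℚ, LinearMap.funLeft ℚ ℚ Sum.inl y = y ∘ Sum.inl := fun _ => rfl
  have e2 : ∀ y : ι ⊕ ι → ℚ, LinearMap.funLeft ℚ ℚ Sum.inr y = y ∘ Sum.inr := fun _ => rfl
  simp only [LinearMap.mem_eqLocus, key, e1, e2]
  constructor
  · intro h y hy
    rw [h, hy, sub_self]
  · intro H
    have h0 : (x ∘ Sum.inl - x ∘ Sum.inr) ᵥ* A = 0 := by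
      refine dotProduct_eq_zero _ fun y => ?_
      have := H (Sum.elim y y)
      simp only [Sum.elim_comp_inl, Sum.elim_comp_inr, forall_const] at this
      rw [← dotProduct_mulVec, sub_dotProduct, this]
    exact sub_eq_zero.mp (eq_zero_of_vecMul_eq_zero hA h0)

end Congruence

namespace RatForm

/-- Orthogonal sum. -/
instance : Add RatForm where
  add A B :=
    { dim := A.dim + B.dim
      mat := (fromBlocks A.mat 0 0 B.mat).submatrix finSumFinEquiv.symm finSumFinEquiv.symm
      symm := by
        rw [IsSymm, transpose_submatrix, fromBlocks_transpose, A.symm.eq, B.symm.eq]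
        simp
      nonsing := by
        rw [det_submatrix_equiv_self, det_fromBlocks_zero₂₁]
        exact mul_ne_zero A.nonsing B.nonsing }

instance : Zero RatForm where
  zero := { dim := 0, mat := 0, symm := by simp, nonsing := by simp }

instance : Neg RatForm where
  neg A :=
    { dim := A.dim
      mat := -A.mat
      symm := A.symm.neg
      nonsing := by
        rw [det_neg]
        exact mul_ne_zero (by simp) A.nonsing }

theorem add_mat (A B : RatForm) : MatCongruent (fromBlocks A.mat 0 0 B.mat) (A + B).mat :=
  MatCongruent.of_equiv finSumFinEquiv _ _ fun i j => by
    change _ = (fromBlocks A.mat 0 0 B.mat).submatrix finSumFinEquiv.symm finSumFinEquiv.symm _ _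
    simp

theorem add_congr {A A' B B' : RatForm} (h : MatCongruent A.mat A'.mat)
    (h' : MatCongruent B.mat B'.mat) : MatCongruent (A + B).mat (A' + B').mat :=
  ((add_mat A B).symm.trans (h.fromBlocks h')).trans (add_mat A' B')

theorem add_comm' (A B : RatForm) : MatCongruent (A + B).mat (B + A).mat :=
  ((add_mat A B).symm.trans (MatCongruent.of_equiv (Equiv.sumComm _ _) _ _ fun i j => by
    rcases i with i | i <;> rcases j with j | j <;> simp)).trans (add_mat B A)

theorem add_assoc' (A B C : RatForm) : MatCongruent (A + B + C).mat (A + (B + C)).mat := by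
  have h1 := (add_mat (A + B) C).symm.trans ((add_mat A B).symm.fromBlocks (MatCongruent.refl C.mat))
  have h2 := ((MatCongruent.refl A.mat).fromBlocks (add_mat B C)).trans (add_mat A (B + C))
  refine (h1.trans (MatCongruent.of_equiv (Equiv.sumAssoc _ _ _) _ _ fun i j => ?_)).trans h2
  rcases i with (i | i) | i <;> rcases j with (j | j) | j <;> simp

theorem zero_add' (A : RatForm) : MatCongruent (0 + A).mat A.mat := by
  refine (add_mat 0 A).symm.trans (MatCongruent.of_equiv (Equiv.emptySum (Fin 0) (Fin A.dim)) _ _ ?_)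
  rintro (i | i) (j | j)
  · exact i.elim0
  · exact i.elim0
  · exact j.elim0
  · simp

theorem metabolic_add {A B : RatForm} (hA : IsMetabolic A.mat) (hB : IsMetabolic B.mat) :
    IsMetabolic (A + B).mat := (hA.fromBlocks hB).congr (add_mat A B)

theorem metabolic_zero : IsMetabolic (0 : RatForm).mat :=
  ⟨⊤, fun x => ⟨fun _ y _ => by
    have : x = 0 := Subsingleton.elim (α := Fin 0 → ℚ) _ _
    rw [this, zero_dotProduct], fun _ => trivial⟩⟩

theorem metabolic_add_neg (A : RatForm) : IsMetabolic (A + -A).mat :=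
  (isMetabolic_fromBlocks_neg A.nonsing).congr (add_mat A (-A))

/-- Two forms are Witt equivalent if they become isometric after adding metabolic forms. -/
def WittEquivalent (A B : RatForm) : Prop :=
  ∃ M N : RatForm, IsMetabolic M.mat ∧ IsMetabolic N.mat ∧ MatCongruent (A + M).mat (B + N).mat

theorem WittEquivalent.of_congruent {A B : RatForm} (h : MatCongruent A.mat B.mat) :
    WittEquivalent A B :=
  ⟨0, 0, metabolic_zero, metabolic_zero, add_congr h (MatCongruent.refl _)⟩

/-- `(A + B) + (C + D) ≅ (A + C) + (B + D)`. -/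
theorem add_add_add_comm' (A B C D : RatForm) :
    MatCongruent (A + B + (C + D)).mat (A + C + (B + D)).mat := by
  refine (add_assoc' A B (C + D)).trans (MatCongruent.trans ?_ (add_assoc' A C (B + D)).symm)
  refine add_congr (MatCongruent.refl _) ?_
  refine (add_assoc' B C D).symm.trans (MatCongruent.trans ?_ (add_assoc' C B D))
  exact add_congr (add_comm' B C) (MatCongruent.refl _)

theorem WittEquivalent.add {A A' B B' : RatForm} (h : WittEquivalent A A')
    (h' : WittEquivalent B B') : WittEquivalent (A + B) (A' + B') := by
  obtain ⟨M, N, hM, hN, h⟩ := h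
  obtain ⟨M', N', hM', hN', h'⟩ := h'
  exact ⟨M + M', N + N', metabolic_add hM hM', metabolic_add hN hN',
    (add_add_add_comm' A B M M').trans ((add_congr h h').trans (add_add_add_comm' A' N B' N'))⟩

theorem neg_add' (A B : RatForm) : MatCongruent (-(A + B)).mat (-A + -B).mat := by
  refine (add_mat A B).symm.neg.trans (MatCongruent.trans ?_ (add_mat (-A) (-B)))
  rw [fromBlocks_neg, neg_zero, neg_zero]
  exact MatCongruent.refl _

theorem WittEquivalent.neg {A A' : RatForm} (h : WittEquivalent A A') :
    WittEquivalent (-A) (-A') := by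
  obtain ⟨M, N, hM, hN, h⟩ := h
  exact ⟨-M, -N, hM.neg, hN.neg, (neg_add' A M).symm.trans (h.neg.trans (neg_add' A' N))⟩

theorem WittEquivalent.trans {A B C : RatForm} (h : WittEquivalent A B)
    (h' : WittEquivalent B C) : WittEquivalent A C := by
  obtain ⟨M, N, hM, hN, h⟩ := h
  obtain ⟨M', N', hM', hN', h'⟩ := h'
  refine ⟨M + M', N' + N, metabolic_add hM hM', metabolic_add hN' hN, ?_⟩
  refine (add_assoc' A M M').symm.trans ((add_congr h (MatCongruent.refl M'.mat)).trans ?_)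
  refine (add_assoc' B N M').trans ((add_congr (MatCongruent.refl _) (add_comm' N M')).trans ?_)
  refine (add_assoc' B M' N).symm.trans ((add_congr h' (MatCongruent.refl _)).trans ?_)
  exact add_assoc' C N' N

instance wittSetoid : Setoid RatForm where
  r := WittEquivalent
  iseqv :=
    { refl := fun _ => WittEquivalent.of_congruent (MatCongruent.refl _)
      symm := fun ⟨M, N, hM, hN, h⟩ => ⟨N, M, hN, hM, h.symm⟩
      trans := WittEquivalent.trans }

end RatForm

/-- The Witt group `W(ℚ)`: non-singular symmetric bilinear forms over `ℚ` up to Witt equivalence,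
with addition induced by the orthogonal sum. -/
def WittGroup : Type := Quotient RatForm.wittSetoid

/-- The Witt class of a symmetric rational matrix with non-zero determinant. -/
def WittGroup.mk {m : ℕ} (A : Matrix (Fin m) (Fin m) ℚ) (hA : A.IsSymm) (hdet : A.det ≠ 0) :
    WittGroup :=
  Quotient.mk RatForm.wittSetoid ⟨m, A, hA, hdet⟩

instance : Add WittGroup where
  add := Quotient.map₂ (· + ·) fun _ _ h _ _ h' => RatForm.WittEquivalent.add h h'

instance : Zero WittGroup where
  zero := Quotient.mk RatForm.wittSetoid 0

instance : Neg WittGroup where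
  neg := Quotient.map (- ·) fun _ _ h => RatForm.WittEquivalent.neg h

instance : AddCommGroup WittGroup where
  nsmul := nsmulRec
  zsmul := zsmulRec
  add_assoc := by
    rintro ⟨A⟩ ⟨B⟩ ⟨C⟩
    exact Quotient.sound (RatForm.WittEquivalent.of_congruent (RatForm.add_assoc' A B C))
  add_comm := by
    rintro ⟨A⟩ ⟨B⟩
    exact Quotient.sound (RatForm.WittEquivalent.of_congruent (RatForm.add_comm' A B))
  zero_add := by
    rintro ⟨A⟩
    exact Quotient.sound (RatForm.WittEquivalent.of_congruent (RatForm.zero_add' A))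
  add_zero := by
    rintro ⟨A⟩
    exact Quotient.sound (RatForm.WittEquivalent.of_congruent
      ((RatForm.add_comm' A 0).trans (RatForm.zero_add' A)))
  neg_add_cancel := by
    rintro ⟨A⟩
    refine Quotient.sound ⟨0, A + -A, RatForm.metabolic_zero, RatForm.metabolic_add_neg A, ?_⟩
    exact (RatForm.add_comm' _ 0).trans
      (RatForm.add_congr (MatCongruent.refl _) (RatForm.add_comm' _ _))

/-- The generator condition of Lickorish: there is a generator `h` of `H₁(Σ(K); ℤ)` with
`l(h, h) = q` in `ℚ/ℤ`. The linking pairing is a pairing on torsion classes, so `h` has finite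
order (which is automatic when `H₁(Σ(K); ℤ)` is finite, as it is for a knot). -/
def HasLinkingGenerator {m : ℕ} (V : Matrix (Fin m) (Fin m) ℤ) (q : ℚ) : Prop :=
  ∃ h : BranchedCoverHomology V, h ∈ AddCommGroup.torsion (BranchedCoverHomology V) ∧
    AddSubgroup.zmultiples h = ⊤ ∧ linkingPairing V h h = (q : AddCircle (1 : ℚ))

/-- The class `φ(K) = [V + Vᵗ]` in `W(ℚ)` of a knot with Seifert matrix `V`. -/
def wittClass {m : ℕ} (V : Matrix (Fin m) (Fin m) ℤ) (h : (symmetrization V).det ≠ 0) :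
    WittGroup :=
  WittGroup.mk (symmetrization V) (symmetrization_isSymm V) h

end

/-! ## Metabolic forms -/

section Metabolic

variable {ι κ : Type*} [Fintype ι] [Fintype κ] [DecidableEq ι] [DecidableEq κ]

/-! Write A = V + Vᵗ and D = det(K), and lift the generator h to an integral vector v. Since h
generates and is torsion, A is non-singular. The condition on l(h, h) provides an integer q with q −
vᵗA⁻¹v = 2ε/D (`exists_int_of_hasLinkingGenerator`). Bordering A by v with corner entry q gives an
integral form U. Completing the square shows that U is rationally A ⊕ ⟨2ε/D⟩ ≅ A ⊕ ⟨2εD⟩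
(`congruent_borderedMatrix`), so det U = ±2. The signature of A determines the sign of D, and for
both permitted values of σ(K) the signature of U is ε.

It remains to see that an integral form of determinant ±2 and signature ε has class ⟨2ε⟩
(`ofMatrix_eq_unary_of_abs_det_eq_two`); then φ(K) = ⟨2ε⟩ − ⟨2εD⟩. For this, W(ℚ) is filtered by the
subgroups generated by the ⟨a⟩ whose prime factors are below k. At an odd prime p, each class in the
successive quotient comes from an anisotropic form over 𝔽_p of rank at most 2
(`mk_mem_anisotropicResidues`). A lattice argument shows that for a form unimodular at p this
residue vanishes (`exists_isotropic_of_isMetabolic`). Descending through the primes, a form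
unimodular at all odd primes equals a⟨1⟩ + b⟨2⟩ (`exists_eq_zsmul_add_zsmul`). As 2⟨2⟩ = 2⟨1⟩,
signature ε leaves only ⟨ε⟩ and ⟨2ε⟩, and the determinant excludes ⟨ε⟩ because a metabolic form has
determinant ± a square. -/

theorem toBilin'_swap {R : Type*} [CommRing R] {A : Matrix ι ι R} (hA : A.IsSymm) (x y : ι → R) :
    A.toBilin' x y = A.toBilin' y x := by
  simp only [Matrix.toBilin'_apply']
  rw [dotProduct_mulVec, dotProduct_comm, ← mulVec_transpose, hA.eq]

theorem toBilin'_isRefl {R : Type*} [CommRing R] {A : Matrix ι ι R} (hA : A.IsSymm) :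
    (A.toBilin').IsRefl := fun x y h => by
  rw [toBilin'_swap hA]; exact h

theorem isMetabolic_iff_orthogonal {A : Matrix ι ι ℚ} (hA : A.IsSymm) :
    IsMetabolic A ↔ ∃ L : Submodule ℚ (ι → ℚ), A.toBilin'.orthogonal L = L := by
  refine exists_congr fun L => ?_
  constructor
  · intro h
    ext x
    rw [LinearMap.BilinForm.mem_orthogonal_iff, h x]
    refine forall₂_congr fun y _ => ?_
    rw [toBilin'_swap hA, toBilin'_apply']
  · intro h x
    conv_lhs => rw [← h]
    rw [LinearMap.BilinForm.mem_orthogonal_iff]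
    refine forall₂_congr fun y _ => ?_
    rw [toBilin'_swap hA, toBilin'_apply']

theorem two_mul_finrank_of_orthogonal_eq {K : Type*} [Field K] {A : Matrix ι ι K}
    (hdet : A.det ≠ 0) {L : Submodule K (ι → K)}
    (hL : A.toBilin'.orthogonal L = L) : 2 * Module.finrank K L = Fintype.card ι := by
  have h := LinearMap.BilinForm.finrank_orthogonal
    (LinearMap.BilinForm.nondegenerate_toBilin'_of_det_ne_zero' A hdet) L
  rw [hL, Module.finrank_pi] at h
  have := L.finrank_le
  rw [Module.finrank_pi] at this
  omega

theorem two_mul_finrank_le_of_isotropic {K : Type*} [Field K] {A : Matrix ι ι K}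
    (hdet : A.det ≠ 0) {L : Submodule K (ι → K)}
    (hL : ∀ x ∈ L, ∀ y ∈ L, x ⬝ᵥ A *ᵥ y = 0) : 2 * Module.finrank K L ≤ Fintype.card ι := by
  have h := LinearMap.BilinForm.finrank_orthogonal
    (LinearMap.BilinForm.nondegenerate_toBilin'_of_det_ne_zero' A hdet) L
  have h1 : L ≤ A.toBilin'.orthogonal L := fun y hy x hx => by
    exact (toBilin'_apply' A x y).trans (hL x hx y hy)
  have h2 := Submodule.finrank_mono h1
  have := L.finrank_le
  rw [h, Module.finrank_pi] at h2
  rw [Module.finrank_pi] at this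
  omega

theorem fromBlocks_diagonal_isSymm {ι κ : Type*} {R : Type*} [CommRing R] {A : Matrix ι ι R} {B : Matrix κ κ R}
    (hA : A.IsSymm) (hB : B.IsSymm) : (fromBlocks A 0 0 B).IsSymm := by
  rw [IsSymm, fromBlocks_transpose, hA.eq, hB.eq, transpose_zero, transpose_zero]

theorem dotProduct_fromBlocks_mulVec {ι κ : Type*} [Fintype ι] [Fintype κ] {R : Type*} [CommRing R] (A : Matrix ι ι R) (B : Matrix κ κ R)
    (x y : ι ⊕ κ → R) : x ⬝ᵥ (fromBlocks A 0 0 B) *ᵥ y =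
      (x ∘ Sum.inl) ⬝ᵥ A *ᵥ (y ∘ Sum.inl) + (x ∘ Sum.inr) ⬝ᵥ B *ᵥ (y ∘ Sum.inr) := by
  rw [fromBlocks_mulVec, dotProduct_block]
  simp

/-- A metabolic summand of a metabolic form can be cancelled. -/
theorem IsMetabolic.of_fromBlocks {A : Matrix ι ι ℚ} {M : Matrix κ κ ℚ} (hA : A.IsSymm)
    (hAdet : A.det ≠ 0) (hM : M.IsSymm) (hMdet : M.det ≠ 0) (hMm : IsMetabolic M)
    (h : IsMetabolic (Matrix.fromBlocks A 0 0 M)) : IsMetabolic A := by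
  have hS := fromBlocks_diagonal_isSymm hA hM
  obtain ⟨L, hL⟩ := hMm
  obtain ⟨N, hN⟩ := (isMetabolic_iff_orthogonal hS).mp h
  set B := (Matrix.fromBlocks A 0 0 M).toBilin' with hB
  have hnd : B.Nondegenerate := LinearMap.BilinForm.nondegenerate_toBilin'_of_det_ne_zero' _ (by
    rw [det_fromBlocks_zero₂₁]; exact mul_ne_zero hAdet hMdet)
  have hrefl : B.IsRefl := toBilin'_isRefl hS
  have hBapp : ∀ x y, B x y =
      (x ∘ Sum.inl) ⬝ᵥ A *ᵥ (y ∘ Sum.inl) + (x ∘ Sum.inr) ⬝ᵥ M *ᵥ (y ∘ Sum.inr) := fun x y => by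
    rw [hB, toBilin'_apply', dotProduct_fromBlocks_mulVec]
  have hMswap : ∀ x y, x ⬝ᵥ M *ᵥ y = y ⬝ᵥ M *ᵥ x := fun x y => by
    simpa only [toBilin'_apply'] using toBilin'_swap hM x y
  -- E is 0 ⊕ L, an isotropic subspace whose orthogonal complement consists of the vectors with
  -- second component in L.
  let E : Submodule ℚ (ι ⊕ κ → ℚ) :=
    (⊥ : Submodule ℚ (ι → ℚ)).comap (LinearMap.funLeft ℚ ℚ Sum.inl) ⊓
      L.comap (LinearMap.funLeft ℚ ℚ Sum.inr)
  have hE : ∀ x, x ∈ E ↔ x ∘ Sum.inl = 0 ∧ x ∘ Sum.inr ∈ L := fun x => Iff.rfl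
  have hEo : ∀ x, x ∈ B.orthogonal E ↔ x ∘ Sum.inr ∈ L := by
    intro x
    rw [LinearMap.BilinForm.mem_orthogonal_iff, hL]
    constructor
    · intro H y hy
      have := H (Sum.elim 0 y) ((hE _).mpr ⟨by simp, by simpa using hy⟩)
      rw [hBapp] at this
      rw [hMswap]
      simpa using this
    · intro H y hy
      rw [hBapp, ((hE y).mp hy).1, hMswap, H _ ((hE y).mp hy).2]
      simp
  -- Isotropic reduction: E^⊥/E is the form A, and the Lagrangian N descends to the image of N ∩
  -- E^⊥.
  refine ⟨(N ⊓ B.orthogonal E).map (LinearMap.funLeft ℚ ℚ Sum.inl), fun a => ?_⟩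
  constructor
  · rintro ⟨x, ⟨hx1, hx2⟩, rfl⟩ _ ⟨y, ⟨hy1, hy2⟩, rfl⟩
    have h1 : B x y = 0 := by
      have := hx1
      rw [SetLike.mem_coe, ← hN] at hy1
      exact hy1 x this
    rw [hBapp, (hL _).mp ((hEo x).mp hx2) _ ((hEo y).mp hy2), add_zero] at h1
    exact h1
  · intro H
    -- For maximality, (a, 0) is orthogonal to N ∩ E^⊥ = (N + E)^⊥, hence lies in N + E; its
    -- N-component projects to a.
    have h1 : (Sum.elim a 0 : ι ⊕ κ → ℚ) ∈ B.orthogonal (B.orthogonal (N ⊔ E)) := by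
      rw [LinearMap.BilinForm.mem_orthogonal_iff]
      intro y hy
      have hyN : y ∈ N := by
        rw [← hN]; exact LinearMap.BilinForm.orthogonal_le le_sup_left hy
      have hyE : y ∈ B.orthogonal E := LinearMap.BilinForm.orthogonal_le le_sup_right hy
      refine hrefl _ _ ?_
      rw [hBapp]
      have := H (y ∘ Sum.inl) ⟨y, ⟨hyN, hyE⟩, rfl⟩
      simpa using this
    rw [LinearMap.BilinForm.orthogonal_orthogonal hnd hrefl] at h1
    obtain ⟨x, hx, e, he, hxe⟩ := Submodule.mem_sup.mp h1
    refine ⟨x, ⟨hx, (hEo x).mpr ?_⟩, ?_⟩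
    · have : x ∘ Sum.inr = -(e ∘ Sum.inr) := by
        ext k
        have := congrFun hxe (Sum.inr k)
        simp only [Pi.add_apply, Sum.elim_inr, Pi.zero_apply] at this
        simp only [Function.comp_apply, Pi.neg_apply]
        linarith
      rw [this]
      exact L.neg_mem ((hE e).mp he).2
    · ext k
      have h2 := congrFun hxe (Sum.inl k)
      have h3 := congrFun ((hE e).mp he).1 k
      simp only [Pi.add_apply, Sum.elim_inl, Function.comp_apply, Pi.zero_apply] at h2 h3
      rw [h3, add_zero] at h2
      exact h2

theorem MatCongruent.isSymm {A : Matrix ι ι ℚ} {B : Matrix κ κ ℚ} (h : MatCongruent A B)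
    (hA : A.IsSymm) : B.IsSymm := by
  obtain ⟨P, Q, -, -, rfl⟩ := h
  rw [IsSymm, transpose_mul, transpose_mul, transpose_transpose, hA.eq, Matrix.mul_assoc]

/-- Congruent matrices have the same determinant up to non-zero rational squares. -/
theorem MatCongruent.exists_det_eq {A : Matrix ι ι ℚ} {B : Matrix κ κ ℚ} (h : MatCongruent A B) :
    ∃ c : ℚ, c ≠ 0 ∧ B.det = c ^ 2 * A.det := by
  obtain ⟨P, Q, h1, h2, rfl⟩ := h
  -- P is indexed by two different types, so its rows are reindexed before a determinant can be
  -- taken.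
  have e : ι ≃ κ := Fintype.equivOfCardEq (Matrix.square_of_invertible P Q h1 h2)
  refine ⟨(P.submatrix e.symm id).det, ?_, ?_⟩
  · have : (P.submatrix e.symm id).det * (Q.submatrix id e.symm).det = 1 := by
      rw [← det_mul, ← submatrix_mul _ _ _ _ _ Function.bijective_id, h1]
      simp
    exact left_ne_zero_of_mul_eq_one this
  · have h3 : Pᵀ * A * P = (P.submatrix e.symm id)ᵀ * A.submatrix e.symm e.symm *
        P.submatrix e.symm id := by
      rw [transpose_submatrix, submatrix_mul_equiv, submatrix_mul_equiv]
      rfl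
    rw [h3, det_mul, det_mul, det_transpose, det_submatrix_equiv_self]
    ring

theorem MatCongruent.det_ne_zero {A : Matrix ι ι ℚ} {B : Matrix κ κ ℚ} (h : MatCongruent A B)
    (hA : A.det ≠ 0) : B.det ≠ 0 := by
  obtain ⟨c, hc, h⟩ := h.exists_det_eq
  rw [h]
  exact mul_ne_zero (pow_ne_zero _ hc) hA

/-- A symmetric rational matrix is congruent to a diagonal one. -/
theorem exists_congruent_diagonal {A : Matrix ι ι ℚ} (hA : A.IsSymm) :
    ∃ d : ι → ℚ, MatCongruent A (diagonal d) := by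
  have : Invertible (2 : ℚ) := invertibleOfNonzero two_ne_zero
  obtain ⟨v, hv⟩ := LinearMap.BilinForm.exists_orthogonal_basis (B := A.toBilin')
    ⟨fun x y => toBilin'_swap hA x y⟩
  let e : Fin (Module.finrank ℚ (ι → ℚ)) ≃ ι :=
    (finCongr (Module.finrank_pi ℚ)).trans (Fintype.equivFin ι).symm
  let w := v.reindex e
  have hw : ∀ i j, i ≠ j → A.toBilin' (w i) (w j) = 0 := fun i j hij => by
    simp only [w, Module.Basis.reindex_apply]
    exact hv (fun h => hij (e.symm.injective h))
  refine ⟨fun i => A.toBilin' (w i) (w i), (Pi.basisFun ℚ ι).toMatrix w, w.toMatrix (Pi.basisFun ℚ ι),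
    Module.Basis.toMatrix_mul_toMatrix_flip _ _, Module.Basis.toMatrix_mul_toMatrix_flip _ _, ?_⟩
  ext i j
  have : (((Pi.basisFun ℚ ι).toMatrix w)ᵀ * A * (Pi.basisFun ℚ ι).toMatrix w) i j =
      A.toBilin' (w i) (w j) := by
    rw [Matrix.toBilin'_apply', Matrix.mul_assoc, Matrix.mul_apply']
    congr 1
  rw [this, diagonal_apply]
  split_ifs with h
  · rw [h]
  · exact hw i j h

/-- The determinant of a non-singular metabolic form is a square up to sign. -/
theorem IsMetabolic.exists_abs_det_eq_sq {A : Matrix ι ι ℚ} (hA : A.IsSymm) (hdet : A.det ≠ 0)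
    (h : IsMetabolic A) : ∃ c : ℚ, |A.det| = c ^ 2 := by
  obtain ⟨L, hL⟩ := (isMetabolic_iff_orthogonal hA).mp h
  obtain ⟨L', hc⟩ := L.exists_isCompl
  have h1 := two_mul_finrank_of_orthogonal_eq hdet hL
  have h2 := Submodule.finrank_add_eq_of_isCompl hc
  rw [Module.finrank_pi] at h2
  let b := Module.finBasis ℚ L
  -- The Lagrangian has half the dimension, so a complement has a basis of the same size and the
  -- Gram matrix has the shape (0 C; Cᵗ *) with C square.
  let b' := Module.finBasisOfFinrankEq ℚ L' (n := Module.finrank ℚ L) (by omega)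
  let w := (b.prod b').map (Submodule.prodEquivOfIsCompl L L' hc)
  have hw : ∀ i j, A.toBilin' (w (Sum.inl i)) (w (Sum.inl j)) = 0 := by
    intro i j
    have e : ∀ i, w (Sum.inl i) = b i := fun i => by simp [w]
    rw [e, e]
    exact (hL.ge (b j).2) _ (b i).2
  let P := (Pi.basisFun ℚ ι).toMatrix w
  have hP : ∀ i j, (Pᵀ * A * P) i j = A.toBilin' (w i) (w j) := by
    intro i j
    rw [Matrix.toBilin'_apply', Matrix.mul_assoc, Matrix.mul_apply']
    congr 1
  have hcong : MatCongruent A (Pᵀ * A * P) :=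
    ⟨P, w.toMatrix (Pi.basisFun ℚ ι), Module.Basis.toMatrix_mul_toMatrix_flip _ _,
      Module.Basis.toMatrix_mul_toMatrix_flip _ _, rfl⟩
  obtain ⟨c, hc0, hcdet⟩ := hcong.exists_det_eq
  have hsymm := hcong.isSymm hA
  set G := Pᵀ * A * P with hG
  have hblk : G = Matrix.fromBlocks 0 G.toBlocks₁₂ G.toBlocks₁₂ᵀ G.toBlocks₂₂ := by
    conv_lhs => rw [← fromBlocks_toBlocks G]
    congr 1
    · ext i j
      exact (hP _ _).trans (hw i j)
    · ext i j
      exact (hsymm.apply _ _)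
  -- Exchanging the two block columns makes the Gram matrix block triangular with diagonal blocks C
  -- and Cᵗ. The sign of this exchange is irrelevant, since only absolute values are compared.
  let J : Matrix (Fin (Module.finrank ℚ L) ⊕ Fin (Module.finrank ℚ L))
    (Fin (Module.finrank ℚ L) ⊕ Fin (Module.finrank ℚ L)) ℚ := Matrix.fromBlocks 0 1 1 0
  have hJ : |J.det| = 1 := by
    have : J.det * J.det = 1 := by
      rw [← det_mul]
      simp [J, fromBlocks_multiply]
    rw [← sq_eq_sq₀ (abs_nonneg _) zero_le_one, sq_abs, sq, this, one_pow]
  have hGJ : G.det * J.det = G.toBlocks₁₂.det ^ 2 := by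
    rw [← det_mul, hblk]
    simp [J, fromBlocks_multiply, sq]
  refine ⟨G.toBlocks₁₂.det / c, ?_⟩
  have h4 : |G.det| = G.toBlocks₁₂.det ^ 2 := by
    rw [← abs_of_nonneg (sq_nonneg G.toBlocks₁₂.det), ← hGJ, abs_mul, hJ, mul_one]
  rw [hcdet, abs_mul, abs_of_nonneg (sq_nonneg c)] at h4
  rw [div_pow, ← h4, mul_div_cancel_left₀ _ (pow_ne_zero _ hc0)]

end Metabolic

/-! ## Signatures -/

section Signature

variable {ι κ : Type*} [Fintype ι] [Fintype κ] [DecidableEq ι] [DecidableEq κ]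
  {K : Type*} [Field K]

theorem toQuadraticForm'_apply (A : Matrix ι ι K) (x : ι → K) :
    A.toQuadraticForm' x = x ⬝ᵥ A *ᵥ x := by
  simp [Matrix.toQuadraticForm', toLinearMap₂'_apply']

theorem equivalent_toQuadraticForm' {A : Matrix ι ι K} {B : Matrix κ κ K} {P : Matrix ι κ K}
    {Q : Matrix κ ι K} (h1 : P * Q = 1) (h2 : Q * P = 1) (h : Pᵀ * A * P = B) :
    QuadraticMap.Equivalent B.toQuadraticForm' A.toQuadraticForm' := by
  refine ⟨⟨Matrix.toLin'OfInv h2 h1, fun x => ?_⟩⟩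
  change A.toQuadraticForm' (P *ᵥ x) = _
  rw [toQuadraticForm'_apply, toQuadraticForm'_apply, ← h, ← mulVec_mulVec, ← mulVec_mulVec,
    dotProduct_mulVec x, vecMul_transpose]

theorem toQuadraticForm'_diagonal (d : ι → K) :
    (diagonal d).toQuadraticForm' = QuadraticMap.weightedSumSquares K d := by
  ext x
  rw [toQuadraticForm'_apply, QuadraticMap.weightedSumSquares_apply]
  simp only [dotProduct, mulVec_diagonal, smul_eq_mul]
  exact Finset.sum_congr rfl fun i _ => by ring

theorem ncard_pos_sub_ncard_neg {ι K : Type*} [Fintype ι] [Field K] [LinearOrder K] (d : ι → K) :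
    (({i | 0 < d i}.ncard : ℕ) : ℤ) - ({i | d i < 0}.ncard : ℕ) =
      ∑ i, (SignType.sign (d i) : ℤ) := by
  have h : ∀ x : K, (SignType.sign x : ℤ) = (if 0 < x then 1 else 0) - (if x < 0 then 1 else 0) := by
    intro x
    rcases lt_trichotomy x 0 with h | h | h
    · simp [h, h.not_gt]
    · simp [h]
    · simp [h, h.not_gt]
  simp only [h, Finset.sum_sub_distrib, Finset.sum_boole, Set.ncard_eq_toFinset_card']
  simp

variable [LinearOrder K] [IsStrictOrderedRing K]

theorem sigPos_sub_sigNeg_of_congruent_diagonal {A : Matrix ι ι K} {d : κ → K} {P : Matrix ι κ K}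
    {Q : Matrix κ ι K} (h1 : P * Q = 1) (h2 : Q * P = 1) (h : Pᵀ * A * P = diagonal d) :
    (sigPos A.toQuadraticForm' : ℤ) - sigNeg A.toQuadraticForm' =
      ∑ i, (SignType.sign (d i) : ℤ) := by
  have h := equivalent_toQuadraticForm' h1 h2 h
  rw [toQuadraticForm'_diagonal] at h
  rw [QuadraticForm.sigPos_of_equiv_weightedSumSquares h.symm,
    QuadraticForm.sigNeg_of_equiv_weightedSumSquares h.symm, ncard_pos_sub_ncard_neg]

/-- The knot signature is defined over ℝ and Witt classes over ℚ; a rational diagonalization, base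
changed to ℝ, computes both. -/
theorem matrixSignature_of_congruent_diagonal {m : ℕ} {A : Matrix (Fin m) (Fin m) ℤ} {d : κ → ℚ}
    (h : MatCongruent (A.map (Int.cast : ℤ → ℚ)) (diagonal d)) :
    matrixSignature A = ∑ i, (SignType.sign (d i) : ℤ) := by
  obtain ⟨P, Q, h1, h2, h3⟩ := h
  let f : ℚ →+* ℝ := Rat.castHom ℝ
  have hA : A.map (Int.cast : ℤ → ℝ) = (A.map (Int.cast : ℤ → ℚ)).map f := by
    ext i j; simp [f]
  have h := sigPos_sub_sigNeg_of_congruent_diagonal (A := A.map (Int.cast : ℤ → ℝ))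
    (d := fun i => f (d i)) (P := P.map f) (Q := Q.map f)
    (by rw [← Matrix.map_mul, h1, Matrix.map_one _ (map_zero f) (map_one f)])
    (by rw [← Matrix.map_mul, h2, Matrix.map_one _ (map_zero f) (map_one f)])
    (by rw [hA, ← transpose_map, ← Matrix.map_mul, ← Matrix.map_mul, h3,
      diagonal_map (map_zero f)])
  rw [matrixSignature, h]
  refine Finset.sum_congr rfl fun i _ => ?_
  congr 1
  rcases lt_trichotomy (d i) 0 with h | h | h
  · simp [f, h]
  · simp [f, h]
  · simp [f, h]

/-- A Lagrangian has half the dimension and meets every definite subspace trivially. Hence at most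
half of the entries are positive and at most half negative, and since none vanishes both bounds are
equalities. -/
theorem IsMetabolic.sum_sign_eq_zero {d : ι → ℚ} (hd : ∀ i, d i ≠ 0)
    (h : IsMetabolic (diagonal d)) : ∑ i, (SignType.sign (d i) : ℤ) = 0 := by
  have hsymm := isSymm_diagonal d
  obtain ⟨L, hL⟩ := (isMetabolic_iff_orthogonal hsymm).mp h
  have hdim := two_mul_finrank_of_orthogonal_eq
    (by rw [det_diagonal]; exact Finset.prod_ne_zero_iff.mpr fun i _ => hd i) hL
  have hzero : ∀ x ∈ L, QuadraticMap.weightedSumSquares ℚ d x = 0 := fun x hx => by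
    rw [← toQuadraticForm'_diagonal, toQuadraticForm'_apply, ← toBilin'_apply']
    exact hL.ge hx x hx
  have h1 := QuadraticForm.sigPos_add_finrank_le_of_nonpos
    (Q := QuadraticMap.weightedSumSquares ℚ d) (V := L) fun x hx => (hzero x hx).le
  have h2 := QuadraticForm.sigPos_add_finrank_le_of_nonpos
    (Q := -QuadraticMap.weightedSumSquares ℚ d) (V := L) fun x hx => by simp [hzero x hx]
  rw [sigPos_neg, QuadraticForm.sigNeg_weightedSumSquares] at h2
  rw [QuadraticForm.sigPos_weightedSumSquares] at h1
  rw [Module.finrank_pi] at h1 h2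
  have h3 : {i | 0 < d i}.ncard + {i | d i < 0}.ncard = Fintype.card ι := by
    have hc : {i | d i < 0} = {i | 0 < d i}ᶜ := by
      ext i
      simp only [Set.mem_ofPred_eq, Set.mem_compl_iff, not_lt]
      exact ⟨le_of_lt, fun h => lt_of_le_of_ne h (hd i)⟩
    rw [hc, Set.ncard_add_ncard_compl, Nat.card_eq_fintype_card]
  rw [← ncard_pos_sub_ncard_neg]
  omega

end Signature

noncomputable section

/-! ### The signature as a Witt invariant of rational forms -/

namespace RatForm

def signature (A : RatForm) : ℤ :=
  (sigPos A.mat.toQuadraticForm' : ℤ) - sigNeg A.mat.toQuadraticForm'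

theorem signature_of_congruent_diagonal {κ : Type*} [Fintype κ] [DecidableEq κ] {A : RatForm}
    {d : κ → ℚ} (h : MatCongruent A.mat (diagonal d)) :
    A.signature = ∑ i, (SignType.sign (d i) : ℤ) := by
  obtain ⟨P, Q, h1, h2, h⟩ := h
  exact sigPos_sub_sigNeg_of_congruent_diagonal h1 h2 h

theorem signature_congr {A B : RatForm} (h : MatCongruent A.mat B.mat) :
    A.signature = B.signature := by
  obtain ⟨d, hd⟩ := exists_congruent_diagonal B.symm
  rw [signature_of_congruent_diagonal hd, signature_of_congruent_diagonal (h.trans hd)]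

theorem signature_add (A B : RatForm) : (A + B).signature = A.signature + B.signature := by
  obtain ⟨d, hd⟩ := exists_congruent_diagonal A.symm
  obtain ⟨e, he⟩ := exists_congruent_diagonal B.symm
  have h := (add_mat A B).symm.trans (hd.fromBlocks he)
  rw [fromBlocks_diagonal] at h
  rw [signature_of_congruent_diagonal hd, signature_of_congruent_diagonal he,
    signature_of_congruent_diagonal h, Fintype.sum_sum_type]
  rfl

theorem signature_of_isMetabolic {A : RatForm} (h : IsMetabolic A.mat) : A.signature = 0 := by
  obtain ⟨d, hd⟩ := exists_congruent_diagonal A.symm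
  rw [signature_of_congruent_diagonal hd]
  refine (h.congr hd).sum_sign_eq_zero fun i => ?_
  have := hd.det_ne_zero A.nonsing
  rw [det_diagonal] at this
  exact Finset.prod_ne_zero_iff.mp this i (Finset.mem_univ i)

/-- Cancellation of metabolic summands removes the stabilization allowed by Witt equivalence, so
vanishing in W(ℚ) becomes a property of the form itself. -/
theorem isMetabolic_of_wittEquivalent_zero {A : RatForm} (h : WittEquivalent A 0) :
    IsMetabolic A.mat := by
  obtain ⟨M, N, hM, hN, h⟩ := h
  have h1 : IsMetabolic (A + M).mat :=
    hN.congr (((zero_add' N).symm).trans h.symm)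
  exact IsMetabolic.of_fromBlocks A.symm A.nonsing M.symm M.nonsing hM (h1.congr (add_mat A M).symm)

end RatForm

/-! ### Witt classes of matrices and relations between one-dimensional forms -/

namespace WittGroup

/-- The signature as a homomorphism `W(ℚ) → ℤ`. -/
def signature : WittGroup →+ ℤ where
  toFun := Quotient.lift RatForm.signature (by
    rintro A B ⟨M, N, hM, hN, h⟩
    have := RatForm.signature_congr h
    rwa [RatForm.signature_add, RatForm.signature_add, RatForm.signature_of_isMetabolic hM,
      RatForm.signature_of_isMetabolic hN, add_zero, add_zero] at this)
  map_zero' := RatForm.signature_of_isMetabolic RatForm.metabolic_zero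
  map_add' := by
    rintro ⟨A⟩ ⟨B⟩
    exact RatForm.signature_add A B

variable {ι κ : Type*} [Fintype ι] [Fintype κ] [DecidableEq ι] [DecidableEq κ]

theorem reindex_congruent (A : Matrix ι ι ℚ) :
    MatCongruent A (reindex (Fintype.equivFin ι) (Fintype.equivFin ι) A) :=
  MatCongruent.of_equiv (Fintype.equivFin ι) _ _ fun i j => by simp

/-- The Witt class of a non-singular symmetric matrix, and `0` for all other matrices. -/
def ofMatrix (A : Matrix ι ι ℚ) : WittGroup :=
  open scoped Classical in
  if h : A.IsSymm ∧ A.det ≠ 0 then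
    mk (reindex (Fintype.equivFin ι) (Fintype.equivFin ι) A) ((reindex_congruent A).isSymm h.1)
      ((reindex_congruent A).det_ne_zero h.2)
  else 0

theorem mk_congr {m n : ℕ} {A : Matrix (Fin m) (Fin m) ℚ} {B : Matrix (Fin n) (Fin n) ℚ}
    (h : MatCongruent A B) (hA : A.IsSymm) (hA' : A.det ≠ 0) (hB : B.IsSymm) (hB' : B.det ≠ 0) :
    mk A hA hA' = mk B hB hB' :=
  Quotient.sound (RatForm.WittEquivalent.of_congruent h)

theorem ofMatrix_eq_mk {m : ℕ} {A : Matrix ι ι ℚ} {B : Matrix (Fin m) (Fin m) ℚ}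
    (h : MatCongruent A B) (hB : B.IsSymm) (hB' : B.det ≠ 0) : ofMatrix A = mk B hB hB' := by
  rw [ofMatrix, dif_pos ⟨h.symm.isSymm hB, h.symm.det_ne_zero hB'⟩]
  exact mk_congr ((reindex_congruent A).symm.trans h) _ _ _ _

theorem mk_eq_ofMatrix {m : ℕ} (A : Matrix (Fin m) (Fin m) ℚ) (hA : A.IsSymm) (hA' : A.det ≠ 0) :
    mk A hA hA' = ofMatrix A :=
  (ofMatrix_eq_mk (MatCongruent.refl A) hA hA').symm

theorem ofMatrix_of_det_eq_zero {A : Matrix ι ι ℚ} (h : A.det = 0) : ofMatrix A = 0 :=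
  dif_neg fun h' => h'.2 h

theorem ofMatrix_congr {A : Matrix ι ι ℚ} {B : Matrix κ κ ℚ} (h : MatCongruent A B) :
    ofMatrix A = ofMatrix B := by
  by_cases hA : A.IsSymm ∧ A.det ≠ 0
  · have hB : B.IsSymm ∧ B.det ≠ 0 := ⟨h.isSymm hA.1, h.det_ne_zero hA.2⟩
    rw [ofMatrix_eq_mk (h.trans (reindex_congruent B)) ((reindex_congruent B).isSymm hB.1)
      ((reindex_congruent B).det_ne_zero hB.2), ofMatrix, dif_pos hB]
  · have hB : ¬ (B.IsSymm ∧ B.det ≠ 0) := fun hB =>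
      hA ⟨h.symm.isSymm hB.1, h.symm.det_ne_zero hB.2⟩
    rw [ofMatrix, ofMatrix, dif_neg hA, dif_neg hB]

theorem ofMatrix_fromBlocks {A : Matrix ι ι ℚ} {B : Matrix κ κ ℚ} (hA : A.IsSymm)
    (hA' : A.det ≠ 0) (hB : B.IsSymm) (hB' : B.det ≠ 0) :
    ofMatrix (fromBlocks A 0 0 B) = ofMatrix A + ofMatrix B := by
  have h1 := reindex_congruent A
  have h2 := reindex_congruent B
  let A' : RatForm := ⟨_, _, h1.isSymm hA, h1.det_ne_zero hA'⟩
  let B' : RatForm := ⟨_, _, h2.isSymm hB, h2.det_ne_zero hB'⟩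
  rw [ofMatrix_eq_mk h1 A'.symm A'.nonsing, ofMatrix_eq_mk h2 B'.symm B'.nonsing]
  exact ofMatrix_eq_mk ((h1.fromBlocks h2).trans (RatForm.add_mat A' B')) (A' + B').symm
    (A' + B').nonsing

theorem ofMatrix_neg (A : Matrix ι ι ℚ) : ofMatrix (-A) = -ofMatrix A := by
  by_cases hA : A.IsSymm ∧ A.det ≠ 0
  · have h1 := reindex_congruent A
    let A' : RatForm := ⟨_, _, h1.isSymm hA.1, h1.det_ne_zero hA.2⟩
    rw [ofMatrix_eq_mk h1 A'.symm A'.nonsing]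
    exact ofMatrix_eq_mk h1.neg (-A').symm (-A').nonsing
  · have hB : ¬ ((-A).IsSymm ∧ (-A).det ≠ 0) := fun hB => by
      refine hA ⟨?_, ?_⟩
      · simpa using hB.1.neg
      · have := hB.2
        rw [det_neg] at this
        exact right_ne_zero_of_mul this
    rw [ofMatrix, ofMatrix, dif_neg hA, dif_neg hB, neg_zero]

theorem isMetabolic_of_ofMatrix_eq_zero {A : Matrix ι ι ℚ} (hA : A.IsSymm) (hA' : A.det ≠ 0)
    (h : ofMatrix A = 0) : IsMetabolic A := by
  have h1 := reindex_congruent A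
  let A' : RatForm := ⟨_, _, h1.isSymm hA, h1.det_ne_zero hA'⟩
  rw [ofMatrix_eq_mk h1 A'.symm A'.nonsing] at h
  exact (RatForm.isMetabolic_of_wittEquivalent_zero (A := A') (Quotient.exact h)).congr h1.symm

/-- The Witt class of the one-dimensional form `⟨a⟩`, and `0` for `a = 0`. -/
def unary (a : ℚ) : WittGroup := ofMatrix (diagonal fun _ : Unit => a)

theorem ofMatrix_of_isEmpty [IsEmpty ι] (A : Matrix ι ι ℚ) : ofMatrix A = 0 :=
  ofMatrix_eq_mk (MatCongruent.of_equiv (Equiv.equivOfIsEmpty ι (Fin 0)) _ _ fun i => isEmptyElim i)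
    (RatForm.symm 0) (RatForm.nonsing 0)

theorem ofMatrix_diagonal_sum {d : ι → ℚ} {e : κ → ℚ} (hd : ∀ i, d i ≠ 0) (he : ∀ i, e i ≠ 0) :
    ofMatrix (diagonal (Sum.elim d e)) = ofMatrix (diagonal d) + ofMatrix (diagonal e) := by
  rw [← fromBlocks_diagonal, ofMatrix_fromBlocks (isSymm_diagonal _) _ (isSymm_diagonal _)] <;>
  · rw [det_diagonal]
    exact Finset.prod_ne_zero_iff.mpr fun i _ => by simp_all

theorem ofMatrix_diagonal_fin {n : ℕ} {d : Fin n → ℚ} (hd : ∀ i, d i ≠ 0) :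
    ofMatrix (diagonal d) = ∑ i, unary (d i) := by
  induction n with
  | zero => rw [ofMatrix_of_isEmpty, Fin.sum_univ_zero]
  | succ n ih =>
    rw [Fin.sum_univ_castSucc, ← ih (fun i => hd _), unary, ← ofMatrix_diagonal_sum
      (fun i => hd _) (fun i => hd _)]
    let e : Fin n ⊕ Unit ≃ Fin (n + 1) :=
      (Equiv.sumCongr (Equiv.refl _) (Equiv.ofUnique Unit (Fin 1))).trans finSumFinEquiv
    refine (ofMatrix_congr (MatCongruent.of_equiv e _ _ fun i j => ?_)).symm
    simp only [diagonal_apply, e.apply_eq_iff_eq]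
    split_ifs
    · rcases i with i | i <;> rfl
    · rfl

theorem ofMatrix_diagonal {d : ι → ℚ} (hd : ∀ i, d i ≠ 0) :
    ofMatrix (diagonal d) = ∑ i, unary (d i) := by
  let e := Fintype.equivFin ι
  rw [ofMatrix_congr (MatCongruent.of_equiv e _ (diagonal (d ∘ e.symm)) fun i j => by
    simp [diagonal_apply]), ofMatrix_diagonal_fin (d := d ∘ e.symm) fun i => hd _]
  exact Equiv.sum_comp e.symm fun i => unary (d i)

theorem exists_eq_sum_unary (x : WittGroup) :
    ∃ (n : ℕ) (d : Fin n → ℚ), (∀ i, d i ≠ 0) ∧ x = ∑ i, unary (d i) := by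
  obtain ⟨A⟩ := x
  obtain ⟨d, hd⟩ := exists_congruent_diagonal A.symm
  have h := hd.det_ne_zero A.nonsing
  rw [det_diagonal] at h
  have hd0 : ∀ i, d i ≠ 0 := fun i => Finset.prod_ne_zero_iff.mp h i (Finset.mem_univ i)
  refine ⟨A.dim, d, hd0, ?_⟩
  rw [← ofMatrix_diagonal hd0, ← ofMatrix_congr hd]
  exact mk_eq_ofMatrix A.mat A.symm A.nonsing

theorem unary_zero : unary 0 = 0 := ofMatrix_of_det_eq_zero (by simp)

theorem unary_neg (a : ℚ) : unary (-a) = -unary a := by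
  rw [unary, unary, ← ofMatrix_neg, diagonal_neg]

theorem unary_mul_sq (a : ℚ) {b : ℚ} (hb : b ≠ 0) : unary (a * b ^ 2) = unary a := by
  refine (ofMatrix_congr ⟨diagonal fun _ => b, diagonal fun _ => b⁻¹, ?_, ?_, ?_⟩).symm
  · simp [hb]
  · simp [hb]
  · ext i j
    simp
    ring

/-- In ⟨a⟩ ⊕ ⟨b⟩ the vector (1, 1) has value a + b, and (−b, a) is orthogonal to it with value ab(a
+ b). The convention `unary 0 = 0` covers the cases a = 0 and b = 0. -/
theorem unary_add_unary {a b : ℚ} (hab : a + b ≠ 0) :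
    unary a + unary b = unary (a + b) + unary (a * b * (a + b)) := by
  by_cases ha : a = 0
  · simp [ha, unary_zero]
  by_cases hb : b = 0
  · simp [hb, unary_zero]
  simp only [unary]
  rw [← ofMatrix_diagonal_sum (fun _ => ha) (fun _ => hb), ← ofMatrix_diagonal_sum (fun _ => hab)
    (fun _ => mul_ne_zero (mul_ne_zero ha hb) hab), ← fromBlocks_diagonal, ← fromBlocks_diagonal]
  refine ofMatrix_congr ⟨fromBlocks (diagonal fun _ => 1) (diagonal fun _ => -b)
    (diagonal fun _ => 1) (diagonal fun _ => a), fromBlocks (diagonal fun _ => a / (a + b))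
    (diagonal fun _ => b / (a + b)) (diagonal fun _ => -1 / (a + b))
    (diagonal fun _ => 1 / (a + b)), ?_, ?_, ?_⟩
  · simp only [fromBlocks_multiply, diagonal_mul_diagonal, diagonal_add, ← fromBlocks_one]
    congr 1 <;> ext i j <;> simp [one_apply] <;> field_simp <;> ring
  · simp only [fromBlocks_multiply, diagonal_mul_diagonal, diagonal_add, ← fromBlocks_one]
    congr 1 <;> ext i j <;> simp [one_apply] <;> field_simp <;> ring
  · simp only [fromBlocks_multiply, fromBlocks_transpose, diagonal_transpose, Matrix.mul_zero,
      add_zero, zero_add, diagonal_mul_diagonal, diagonal_add]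
    congr 1 <;> ext i j <;> simp <;> ring

theorem signature_ofMatrix_diagonal {d : ι → ℚ} (hd : ∀ i, d i ≠ 0) :
    signature (ofMatrix (diagonal d)) = ∑ i, (SignType.sign (d i) : ℤ) := by
  have h := reindex_congruent (diagonal d)
  let A' : RatForm := ⟨_, _, h.isSymm (isSymm_diagonal d), h.det_ne_zero (by
    rw [det_diagonal]; exact Finset.prod_ne_zero_iff.mpr fun i _ => hd i)⟩
  rw [ofMatrix_eq_mk h A'.symm A'.nonsing]
  exact RatForm.signature_of_congruent_diagonal (A := A') h.symm

theorem signature_unary (a : ℚ) : signature (unary a) = (SignType.sign a : ℤ) := by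
  by_cases ha : a = 0
  · simp [ha, unary_zero]
  · rw [unary, signature_ofMatrix_diagonal fun _ => ha]
    simp

end WittGroup

end

/-! ## Residues of metabolic forms -/

section Residue

theorem map_dotProduct_mulVec {R S ι κ : Type*} [CommRing R] [CommRing S] [Fintype ι] [Fintype κ]
    (f : R →+* S) (M : Matrix ι κ R) (x : ι → R) (y : κ → R) :
    f (x ⬝ᵥ M *ᵥ y) = (f ∘ x) ⬝ᵥ M.map f *ᵥ (f ∘ y) := by
  simp [dotProduct, mulVec]

variable {ι κ : Type*} [Fintype ι] [Fintype κ] [DecidableEq ι] [DecidableEq κ]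

/-- The integral vectors in a rational subspace. -/
def integralPoints {N : Type*} (L : Submodule ℚ (N → ℚ)) : Submodule ℤ (N → ℤ) :=
  (L.restrictScalars ℤ).comap (LinearMap.compLeft (Algebra.linearMap ℤ ℚ) N)

theorem mem_integralPoints {N : Type*} {L : Submodule ℚ (N → ℚ)} {x : N → ℤ} :
    x ∈ integralPoints L ↔ (Int.castRingHom ℚ ∘ x) ∈ L := Iff.rfl

theorem exists_smul_eq_intCast {N : Type*} [Fintype N] (x : N → ℚ) :
    ∃ (m : ℤ) (y : N → ℤ), m ≠ 0 ∧ (m : ℚ) • x = Int.castRingHom ℚ ∘ y := by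
  obtain ⟨⟨m, hm⟩, h⟩ := IsLocalization.exist_integer_multiples_of_finite (nonZeroDivisors ℤ) x
  choose y hy using h
  refine ⟨m, y, nonZeroDivisors.ne_zero hm, ?_⟩
  ext i
  have := hy i
  simp only [eq_intCast, zsmul_eq_mul] at this
  simp [this]

/-- Clearing denominators shows that a ℤ-basis of the integral points spans L over ℚ. -/
theorem finrank_le_finrank_integralPoints {N : Type*} [Fintype N] (L : Submodule ℚ (N → ℚ)) :
    Module.finrank ℚ L ≤ Module.finrank ℤ (integralPoints L) := by
  classical
  let b := Module.finBasis ℤ (integralPoints L)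
  let v : Fin (Module.finrank ℤ (integralPoints L)) → N → ℚ :=
    fun i => Int.castRingHom ℚ ∘ (b i : N → ℤ)
  have hL : L ≤ Submodule.span ℚ (Set.range v) := by
    intro x hx
    obtain ⟨m, y, hm, hy⟩ := exists_smul_eq_intCast x
    have hyL : y ∈ integralPoints L := by
      rw [mem_integralPoints, ← hy]
      exact L.smul_mem _ hx
    have h1 : (m : ℚ) • x ∈ Submodule.span ℚ (Set.range v) := by
      have h2 : (m : ℚ) • x = ∑ i, ((b.repr ⟨y, hyL⟩ i : ℤ) : ℚ) • v i := by
        have h3 := congrArg Subtype.val (b.sum_repr ⟨y, hyL⟩)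
        rw [hy]
        ext k
        have h4 := congrFun h3 k
        simp only [Submodule.coe_sum, Submodule.coe_smul, Finset.sum_apply, Pi.smul_apply,
          smul_eq_mul] at h4
        simp [v, Finset.sum_apply, ← h4]
      rw [h2]
      exact Submodule.sum_mem _ fun i _ =>
        Submodule.smul_mem _ _ (Submodule.subset_span ⟨i, rfl⟩)
    exact (Submodule.smul_mem_iff _ (Int.cast_ne_zero.mpr hm)).mp h1
  refine (Submodule.finrank_mono hL).trans ?_
  exact (finrank_range_le_card (R := ℚ) v).trans_eq (Fintype.card_fin _)

/-- If the orthogonal sum of an integral form `G` that is unimodular at `p` and of `p` times an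
integral form `W` is metabolic over `ℚ`, then `W` is isotropic modulo `p`. -/
theorem exists_isotropic_of_isMetabolic {p : ℕ} [Fact p.Prime] {G : Matrix ι ι ℤ}
    {W : Matrix κ κ ℤ} [Nonempty κ] (hG : G.IsSymm) (hGp : ¬ (p : ℤ) ∣ G.det) (hW : W.IsSymm)
    (hmet : IsMetabolic (fromBlocks (G.map (Int.castRingHom ℚ)) 0 0
      (((p : ℤ) • W).map (Int.castRingHom ℚ)))) :
    ∃ z : κ → ZMod p, z ≠ 0 ∧ z ⬝ᵥ W.map (Int.castRingHom (ZMod p)) *ᵥ z = 0 := by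
  by_contra! hani
  have hp0 : (p : ℤ) ≠ 0 := Int.natCast_ne_zero.mpr (Fact.out : p.Prime).ne_zero
  have hcast : ∀ {x : ℤ}, (p : ℤ) ∣ x ↔ (x : ZMod p) = 0 := fun {x} =>
    (ZMod.intCast_zmod_eq_zero_iff_dvd x p).symm
  have hGdet : (G.map (Int.castRingHom (ZMod p))).det ≠ 0 := by
    rw [← RingHom.mapMatrix_apply, ← RingHom.map_det]
    exact fun h => hGp (hcast.mpr h)
  -- Anisotropy modulo p forces W to be non-singular, which makes the whole sum non-singular over ℚ
  -- and gives its Lagrangian exactly half the dimension.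
  have hWdet : W.det ≠ 0 := by
    intro h
    have h1 : (W.map (Int.castRingHom (ZMod p))).det = 0 := by
      rw [← RingHom.mapMatrix_apply, ← RingHom.map_det, h, map_zero]
    obtain ⟨z, hz, hz'⟩ := Matrix.exists_mulVec_eq_zero_iff.mpr h1
    exact hani z hz (by rw [hz', dotProduct_zero])
  set A := fromBlocks G 0 0 ((p : ℤ) • W) with hA
  have hAQ : A.map (Int.castRingHom ℚ) = fromBlocks (G.map (Int.castRingHom ℚ)) 0 0
      (((p : ℤ) • W).map (Int.castRingHom ℚ)) := by
    rw [hA, fromBlocks_map]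
    simp
  have hAsymm : (A.map (Int.castRingHom ℚ)).IsSymm :=
    (fromBlocks_diagonal_isSymm hG (hW.smul _)).map _
  have hAdet : (A.map (Int.castRingHom ℚ)).det ≠ 0 := by
    rw [← RingHom.mapMatrix_apply, ← RingHom.map_det, hA, det_fromBlocks_zero₂₁, det_smul]
    have : G.det ≠ 0 := fun h => hGp (h ▸ dvd_zero _)
    simp only [eq_intCast, ne_eq, Int.cast_eq_zero, mul_eq_zero, pow_eq_zero_iff', not_or]
    tauto
  rw [← hAQ] at hmet
  obtain ⟨L, hL⟩ := (isMetabolic_iff_orthogonal hAsymm).mp hmet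
  have hdim := two_mul_finrank_of_orthogonal_eq hAdet hL
  have hle := finrank_le_finrank_integralPoints L
  set d := Module.finrank ℤ (integralPoints L) with hd
  let b := Module.finBasis ℤ (integralPoints L)
  have hiso : ∀ x ∈ integralPoints L, ∀ y ∈ integralPoints L,
      (x ∘ Sum.inl) ⬝ᵥ G *ᵥ (y ∘ Sum.inl) + p * ((x ∘ Sum.inr) ⬝ᵥ W *ᵥ (y ∘ Sum.inr)) = 0 := by
    intro x hx y hy
    have h1 : (A.map (Int.castRingHom ℚ)).toBilin' (Int.castRingHom ℚ ∘ x) (Int.castRingHom ℚ ∘ y) = 0 :=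
      hL.ge hy _ hx
    rw [toBilin'_apply', ← map_dotProduct_mulVec, eq_intCast, Int.cast_eq_zero, hA,
      dotProduct_fromBlocks_mulVec, smul_mulVec, dotProduct_smul, smul_eq_mul] at h1
    exact h1
  let red : (ι ⊕ κ → ℤ) → (ι → ZMod p) := fun x => Int.castRingHom (ZMod p) ∘ (x ∘ Sum.inl)
  -- φ reduces the lattice of integral points of the Lagrangian modulo p and keeps only the
  -- coordinates belonging to G.
  let φ : (Fin d → ZMod p) →ₗ[ZMod p] (ι → ZMod p) :=
    Fintype.linearCombination (ZMod p) fun i => red (b i)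
  have hφ : ∀ c : Fin d → ZMod p, ∃ c' : Fin d → ℤ, (∀ i, (c' i : ZMod p) = c i) ∧
      φ c = red (∑ i, c' i • b i : integralPoints L) := by
    intro c
    choose c' hc' using fun i => ZMod.intCast_surjective (c i)
    refine ⟨c', hc', ?_⟩
    ext k
    simp [φ, red, Fintype.linearCombination_apply, Finset.sum_apply, hc']
  -- If the G-coordinates of x are p·u, then p²G(u, u) + pW = 0 makes the W-value divisible by p.
  -- Anisotropy then makes the W-coordinates divisible by p too, so x = p·y, and y again lies in the
  -- lattice because L is a rational subspace.
  have hinj : Function.Injective φ := by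
    rw [← LinearMap.ker_eq_bot, LinearMap.ker_eq_bot']
    intro c hc
    obtain ⟨c', hc', hx⟩ := hφ c
    set x := ∑ i, c' i • b i with hxdef
    rw [hc] at hx
    have hu : ∀ k, (p : ℤ) ∣ (x : ι ⊕ κ → ℤ) (Sum.inl k) := fun k =>
      hcast.mpr (congrFun hx k).symm
    choose u hu using hu
    have h1 := hiso x x.2 x x.2
    have hxu : (x : ι ⊕ κ → ℤ) ∘ Sum.inl = (p : ℤ) • u := by
      ext k
      simp [hu]
    rw [hxu, mulVec_smul, smul_dotProduct, smul_eq_mul, ← mul_add] at h1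
    have h2 := (mul_eq_zero.mp h1).resolve_left hp0
    have h3 : (Int.castRingHom (ZMod p)) (((x : ι ⊕ κ → ℤ) ∘ Sum.inr) ⬝ᵥ
        W *ᵥ ((x : ι ⊕ κ → ℤ) ∘ Sum.inr)) = 0 := by
      rw [eq_intCast, ← hcast, dotProduct_smul, smul_eq_mul] at *
      exact ⟨-(u ⬝ᵥ G *ᵥ u), by linarith⟩
    rw [map_dotProduct_mulVec] at h3
    have h4 : Int.castRingHom (ZMod p) ∘ ((x : ι ⊕ κ → ℤ) ∘ Sum.inr) = 0 := by
      by_contra h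
      exact hani _ h h3
    have h5 : ∀ k, (p : ℤ) ∣ (x : ι ⊕ κ → ℤ) k := by
      rintro (k | k)
      · exact ⟨u k, hu k⟩
      · exact hcast.mpr (congrFun h4 k)
    choose y hy using h5
    have hyL : y ∈ integralPoints L := by
      have h6 : (Int.castRingHom ℚ ∘ (x : ι ⊕ κ → ℤ)) ∈ L := x.2
      have h7 : Int.castRingHom ℚ ∘ (x : ι ⊕ κ → ℤ) = (p : ℚ) • (Int.castRingHom ℚ ∘ y) := by
        ext k
        simp [hy]
      rw [h7] at h6
      exact mem_integralPoints.mpr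
        ((Submodule.smul_mem_iff L (by exact_mod_cast hp0 : (p : ℚ) ≠ 0)).mp h6)
    have hxy : x = (p : ℤ) • (⟨y, hyL⟩ : integralPoints L) := by
      ext k
      simp [hy]
    ext i
    have h8 : c' i = p * b.repr ⟨y, hyL⟩ i := by
      have h9 : b.repr x i = c' i := by
        rw [hxdef, b.repr_sum_self]
      rw [← h9, hxy, map_smul]
      simp
    rw [← hc' i, h8]
    simp
  have hiso' : ∀ x ∈ LinearMap.range φ, ∀ y ∈ LinearMap.range φ,
      x ⬝ᵥ G.map (Int.castRingHom (ZMod p)) *ᵥ y = 0 := by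
    rintro _ ⟨c, rfl⟩ _ ⟨c', rfl⟩
    obtain ⟨e, -, he⟩ := hφ c
    obtain ⟨e', -, he'⟩ := hφ c'
    rw [he, he', ← map_dotProduct_mulVec, eq_intCast, ← hcast]
    have := hiso _ (∑ i, e i • b i).2 _ (∑ i, e' i • b i).2
    exact ⟨_, (eq_neg_of_add_eq_zero_left this).trans (neg_mul_eq_mul_neg _ _)⟩
  -- The image is isotropic for the non-singular form G mod p, so 2d is at most the rank of G,
  -- whereas 2d is at least the rank of G plus the positive rank of W.
  have h10 := two_mul_finrank_le_of_isotropic hGdet hiso'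
  rw [LinearMap.finrank_range_of_inj hinj, Module.finrank_pi, Fintype.card_fin] at h10
  rw [Fintype.card_sum] at hdim
  have := Fintype.card_pos (α := κ)
  omega

end Residue

/-! ## The filtration of `W(ℚ)` by primes -/

noncomputable section

/-- All prime factors of the non-zero integer `a` are smaller than `k`. -/
def IsSmoothInt (k : ℕ) (a : ℤ) : Prop := a.natAbs ∈ Nat.smoothNumbers k

namespace IsSmoothInt

variable {k : ℕ} {a b : ℤ}

theorem ne_zero (h : IsSmoothInt k a) : a ≠ 0 :=
  Int.natAbs_ne_zero.mp (Nat.ne_zero_of_mem_smoothNumbers h)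

theorem mul (ha : IsSmoothInt k a) (hb : IsSmoothInt k b) : IsSmoothInt k (a * b) := by
  rw [IsSmoothInt, Int.natAbs_mul]
  exact Nat.mul_mem_smoothNumbers ha hb

theorem neg (ha : IsSmoothInt k a) : IsSmoothInt k (-a) := by
  rwa [IsSmoothInt, Int.natAbs_neg]

theorem of_abs_lt (h0 : a ≠ 0) (h : |a| < k) : IsSmoothInt k a :=
  Nat.mem_smoothNumbers_of_lt (Int.natAbs_pos.mpr h0) (by
    rw [Int.abs_eq_natAbs] at h; exact_mod_cast h)

theorem not_dvd {p : ℕ} (hp : p.Prime) (ha : IsSmoothInt p a) : ¬ (p : ℤ) ∣ a := fun h =>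
  (hp.coprime_iff_not_dvd.mp (hp.smoothNumbers_coprime ha)) (Int.natCast_dvd.mp h)

theorem cast_ne_zero {p : ℕ} (hp : p.Prime) (ha : IsSmoothInt p a) : (a : ZMod p) ≠ 0 := fun h =>
  ha.not_dvd hp ((ZMod.intCast_zmod_eq_zero_iff_dvd a p).mp h)

theorem exists_eq_pow_mul {p : ℕ} (hp : p.Prime) (ha : IsSmoothInt (p + 1) a) :
    ∃ (e : ℕ) (w : ℤ), IsSmoothInt p w ∧ a = p ^ e * w := by
  obtain ⟨w, haw, hw⟩ := FiniteMultiplicity.exists_eq_pow_mul_and_not_dvd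
    (Int.finiteMultiplicity_iff.mpr ⟨by simpa using hp.ne_one, ha.ne_zero⟩ :
      FiniteMultiplicity (p : ℤ) a)
  refine ⟨_, w, ?_, haw⟩
  have hw0 : w ≠ 0 := fun h => hw (h ▸ dvd_zero _)
  refine ⟨Int.natAbs_ne_zero.mpr hw0, fun q hq => ?_⟩
  have hqp := Nat.prime_of_mem_primeFactorsList hq
  have hqw := Nat.dvd_of_mem_primeFactorsList hq
  have h1 : q < p + 1 := ha.2 q ((Nat.mem_primeFactorsList ha.1).mpr
    ⟨hqp, by rw [haw, Int.natAbs_mul]; exact hqw.mul_left _⟩)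
  have h2 : q ≠ p := fun h => hw (by rw [← h]; exact Int.natCast_dvd.mpr hqw)
  omega

end IsSmoothInt

namespace WittGroup

/-- The subgroup of `W(ℚ)` generated by the forms `⟨a⟩`, where `a` is a non-zero integer all of
whose prime factors are smaller than `k`. -/
def smoothSubgroup (k : ℕ) : AddSubgroup WittGroup :=
  AddSubgroup.closure {x | ∃ a : ℤ, IsSmoothInt k a ∧ x = unary a}

theorem unary_mem_smoothSubgroup {k : ℕ} {a : ℤ} (ha : IsSmoothInt k a) :
    unary a ∈ smoothSubgroup k :=
  AddSubgroup.subset_closure ⟨a, ha, rfl⟩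

theorem exists_mem_smoothSubgroup (x : WittGroup) : ∃ k, 3 ≤ k ∧ x ∈ smoothSubgroup k := by
  obtain ⟨n, d, hd, rfl⟩ := exists_eq_sum_unary x
  let a : Fin n → ℤ := fun i => (d i).num * (d i).den
  have ha : ∀ i, unary (d i) = unary (a i) := fun i => by
    have h0 : ((d i).den : ℚ) ≠ 0 := Nat.cast_ne_zero.mpr (d i).den_nz
    rw [← unary_mul_sq (d i) h0]
    congr 1
    simp only [a]
    push_cast
    rw [sq, ← mul_assoc, Rat.mul_den_eq_num]
  -- The summand 3 makes the bound strict and gives the descent through the primes its lower end.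
  refine ⟨∑ i, (a i).natAbs + 3, by omega, AddSubgroup.sum_mem _ fun i _ => ?_⟩
  rw [ha]
  refine unary_mem_smoothSubgroup (Nat.mem_smoothNumbers_of_lt (Int.natAbs_pos.mpr ?_) ?_)
  · exact mul_ne_zero (Rat.num_ne_zero.mpr (hd i)) (Int.natCast_ne_zero.mpr (d i).den_nz)
  · have := Finset.single_le_sum (f := fun i => (a i).natAbs) (fun i _ => Nat.zero_le _)
      (Finset.mem_univ i)
    omega

/-- The class of `⟨p u⟩` modulo the subgroup generated by forms of smaller primes. -/
def residueClass (p : ℕ) (u : ℤ) : WittGroup ⧸ smoothSubgroup p :=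
  QuotientAddGroup.mk (unary (p * u : ℤ))

theorem residueClass_neg {p : ℕ} (u : ℤ) : residueClass p (-u) = -residueClass p u := by
  rw [residueClass, residueClass, ← QuotientAddGroup.mk_neg, ← unary_neg]
  congr 2
  push_cast
  ring

theorem residueClass_mul_sq {p : ℕ} (u : ℤ) {t : ℤ} (ht : t ≠ 0) :
    residueClass p (u * t ^ 2) = residueClass p u := by
  rw [residueClass, residueClass, ← unary_mul_sq ((p * u : ℤ) : ℚ) (Int.cast_ne_zero.mpr ht)]
  congr 2
  push_cast
  ring

/-! ### Residue classes and square classes modulo p -/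

section Prime

variable {p : ℕ} [hp : Fact p.Prime]

theorem residueClass_add {a b : ℤ} (hab : a + b ≠ 0) :
    residueClass p a + residueClass p b = residueClass p (a + b) +
      residueClass p (a * b * (a + b)) := by
  have hp0 : (p : ℚ) ≠ 0 := Nat.cast_ne_zero.mpr hp.out.ne_zero
  have h0 : ((a : ℚ) + b) ≠ 0 := by exact_mod_cast hab
  have h := unary_add_unary (a := p * a) (b := p * b) (by rw [← mul_add]; exact mul_ne_zero hp0 h0)
  have h1 : (p * a * (p * b) * (p * a + p * b) : ℚ) = (p * (a * b * (a + b)) : ℚ) * p ^ 2 := by ring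
  rw [h1, unary_mul_sq _ hp0, ← mul_add] at h
  simp only [residueClass, ← QuotientAddGroup.mk_add]
  push_cast
  rw [h]

/-- Apply `unary_add_unary` to pcm = pcr + clp². Up to squares the two remaining terms are ⟨cl⟩ and
⟨rlmc⟩, which die in the quotient; the bound on l serves to make l itself smooth. -/
theorem residueClass_mul_eq_of_eq_add {c m r l : ℤ} (hc : IsSmoothInt p c) (hm : IsSmoothInt p m)
    (hr : IsSmoothInt p r) (hl : |l| < p) (h : m = r + l * p) :
    residueClass p (c * m) = residueClass p (c * r) := by
  by_cases hl0 : l = 0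
  · rw [h, hl0, zero_mul, add_zero]
  have hp0 : (p : ℚ) ≠ 0 := Nat.cast_ne_zero.mpr hp.out.ne_zero
  have hls := IsSmoothInt.of_abs_lt hl0 hl
  have hsum : (p * (c * r) : ℚ) + c * l * p ^ 2 = p * (c * m) := by
    rw [h]; push_cast; ring
  have hne : (p * (c * m) : ℚ) ≠ 0 :=
    mul_ne_zero hp0 (mul_ne_zero (Int.cast_ne_zero.mpr hc.ne_zero) (Int.cast_ne_zero.mpr hm.ne_zero))
  have h1 := unary_add_unary (a := p * (c * r)) (b := c * l * p ^ 2) (by rwa [hsum])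
  have h2 : (p * (c * r) * (c * l * p ^ 2) * (p * (c * m)) : ℚ) =
      ((r * l * m * c : ℤ) : ℚ) * (p ^ 2 * c) ^ 2 := by push_cast; ring
  rw [hsum, h2, unary_mul_sq _ hp0, unary_mul_sq _ (mul_ne_zero (pow_ne_zero _ hp0)
    (Int.cast_ne_zero.mpr hc.ne_zero))] at h1
  rw [residueClass, residueClass, QuotientAddGroup.eq]
  have h3 := unary_mem_smoothSubgroup (hc.mul hls)
  have h4 := unary_mem_smoothSubgroup (((hr.mul hls).mul hm).mul hc)
  have h5 : -unary (p * (c * m) : ℤ) + unary (p * (c * r) : ℤ) =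
      unary (r * l * m * c : ℤ) - unary (c * l : ℤ) := by
    push_cast at h1 ⊢
    rw [neg_add_eq_sub, sub_eq_sub_iff_add_eq_add, h1, add_comm]
  rw [h5]
  exact AddSubgroup.sub_mem _ h4 h3

theorem isSmoothInt_mod {u : ℕ} (hu : u ∈ Nat.smoothNumbers p) : IsSmoothInt p (u % p : ℕ) := by
  have h1 : u % p ≠ 0 := fun h => (hp.out.coprime_iff_not_dvd.mp (hp.out.smoothNumbers_coprime hu))
    (Nat.dvd_of_mod_eq_zero h)
  have h2 := Nat.mod_lt u hp.out.pos
  rw [IsSmoothInt, Int.natAbs_natCast]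
  exact Nat.mem_smoothNumbers_of_lt (Nat.pos_of_ne_zero h1) h2

/-- A large u cannot be reduced modulo p in one step, as u / p need not be smooth. Its prime factors
are already below p, so it is reduced factor by factor: a product of two remainders is below p², and
its quotient by p is below p. The factor c carries the rest of the product along. -/
theorem residueClass_mul_natCast (u : ℕ) : u ∈ Nat.smoothNumbers p → ∀ c : ℤ, IsSmoothInt p c →
    residueClass p (c * u) = residueClass p (c * (u % p : ℕ)) := by
  induction u using Nat.recOnMul with
  | zero => intro h; exact absurd rfl (Nat.ne_zero_of_mem_smoothNumbers h)
  | one => intro _ c _; rw [Nat.mod_eq_of_lt hp.out.one_lt]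
  | prime q hq =>
    intro h c _
    rw [Nat.mod_eq_of_lt (Nat.mem_smoothNumbers'.mp h q hq dvd_rfl)]
  | mul a b iha ihb =>
    intro h c hc
    have ha := Nat.mem_smoothNumbers_of_dvd h (dvd_mul_right a b)
    have hb := Nat.mem_smoothNumbers_of_dvd h (dvd_mul_left b a)
    have hbs : IsSmoothInt p (b : ℤ) := by simpa [IsSmoothInt] using hb
    have ha' := isSmoothInt_mod ha
    have hb' := isSmoothInt_mod hb
    have e1 : c * ((a * b : ℕ) : ℤ) = c * b * a := by push_cast; ring
    have e2 : c * b * ((a % p : ℕ) : ℤ) = c * (a % p : ℕ) * b := by ring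
    rw [e1, iha ha _ (hc.mul hbs), e2, ihb hb _ (hc.mul ha'), mul_assoc]
    refine residueClass_mul_eq_of_eq_add (l := ((a % p) * (b % p) / p : ℕ)) hc (ha'.mul hb')
      (isSmoothInt_mod h) ?_ ?_
    · rw [Nat.abs_cast]
      exact_mod_cast Nat.div_lt_of_lt_mul
        (Nat.mul_lt_mul'' (Nat.mod_lt a hp.out.pos) (Nat.mod_lt b hp.out.pos))
    · rw [Nat.mul_mod]
      exact_mod_cast (Nat.mod_add_div' _ p).symm

theorem residueClass_emod {u : ℤ} (hu : IsSmoothInt p u) :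
    residueClass p u = residueClass p (u % p) := by
  have h1 : IsSmoothInt p 1 := IsSmoothInt.of_abs_lt one_ne_zero (by
    rw [abs_one]; exact_mod_cast hp.out.one_lt)
  obtain ⟨n, rfl | rfl⟩ := u.eq_nat_or_neg
  · have := residueClass_mul_natCast n (by simpa [IsSmoothInt] using hu) 1 h1
    simpa using this
  · have hn : n ∈ Nat.smoothNumbers p := by simpa [IsSmoothInt] using hu
    have h2 := residueClass_mul_natCast n hn (-1) h1.neg
    have hs := isSmoothInt_mod hn
    have hlt : n % p < p := Nat.mod_lt n hp.out.pos
    have hpos : n % p ≠ 0 := by exact_mod_cast hs.ne_zero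
    have e1 : (-(n : ℤ)) % p = p - (n % p : ℕ) := by
      have : (-(n : ℤ)) = (p - (n % p : ℕ)) + p * (-(n / p : ℕ) - 1) := by
        have : (n : ℤ) = (n % p : ℕ) + p * (n / p : ℕ) := by exact_mod_cast (Nat.mod_add_div n p).symm
        linarith
      rw [this, Int.add_mul_emod_self_left, Int.emod_eq_of_lt (by omega) (by omega)]
    -- For negative u the remainder is p − r rather than −r; the two differ by 1 · p.
    have h3 := residueClass_mul_eq_of_eq_add (p := p) (c := 1) (m := p - (n % p : ℕ))
      (r := -(n % p : ℕ)) (l := 1) h1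
      (IsSmoothInt.of_abs_lt (by omega) (by rw [abs_lt]; omega)) hs.neg
      (by rw [abs_one]; exact_mod_cast hp.out.one_lt) (by ring)
    rw [one_mul, one_mul] at h3
    rw [neg_one_mul, neg_one_mul] at h2
    rw [e1, h3, h2]

/-- Lifting t to its representative below p keeps v t² smooth, and both sides then have the same
remainder modulo p. So the residue class depends only on the square class in 𝔽_p. -/
theorem residueClass_eq_of_cast_eq {u v : ℤ} (hu : IsSmoothInt p u) (hv : IsSmoothInt p v)
    {t : ZMod p} (ht : t ≠ 0) (h : (u : ZMod p) = v * t ^ 2) :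
    residueClass p u = residueClass p v := by
  have ht0 : t.val ≠ 0 := fun h => ht ((ZMod.val_eq_zero t).mp h)
  have hts : IsSmoothInt p (t.val : ℤ) := IsSmoothInt.of_abs_lt (by exact_mod_cast ht0) (by
    rw [Nat.abs_cast]; exact_mod_cast t.val_lt)
  have h1 : (u : ZMod p) = (v * (t.val : ℤ) ^ 2 : ℤ) := by
    rw [h]; push_cast; rw [ZMod.natCast_zmod_val]
  have hvt : IsSmoothInt p (v * (t.val : ℤ) ^ 2) := by
    rw [sq]; exact hv.mul (hts.mul hts)
  rw [← residueClass_mul_sq v hts.ne_zero, residueClass_emod hu, residueClass_emod hvt,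
    (ZMod.intCast_eq_intCast_iff _ _ p).mp h1]

theorem exists_add_sq_eq (hp2 : p ≠ 2) {a b : ZMod p} (ha : a ≠ 0) (hb : b ≠ 0) (c : ZMod p) :
    ∃ x y : ZMod p, a * x ^ 2 + b * y ^ 2 = c := by
  open Polynomial in
  obtain ⟨x, y, h⟩ := FiniteField.exists_root_sum_quadratic (R := ZMod p)
    (f := C a * X ^ 2 + C 0 * X + C 0) (g := C b * X ^ 2 + C 0 * X + C (-c))
    (degree_quadratic ha) (degree_quadratic hb)
    (by rw [ZMod.card]; exact Nat.odd_iff.mp (hp.out.odd_of_ne_two hp2))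
  refine ⟨x, y, ?_⟩
  simp at h
  linear_combination h

/-- The classes of anisotropic residue forms. -/
def anisotropicResidues (p : ℕ) : Set (WittGroup ⧸ smoothSubgroup p) :=
  {x | x = 0 ∨ (∃ w, IsSmoothInt p w ∧ x = residueClass p w) ∨
    ∃ v w, IsSmoothInt p v ∧ IsSmoothInt p w ∧ ¬ IsSquare (-(v * w) : ZMod p) ∧
      x = residueClass p v + residueClass p w}

/-- If −vw = s², then w = −v (s/v)² modulo p, so the two classes are opposite: an isotropic binary
form is hyperbolic. -/
theorem residueClass_add_eq_zero {v w : ℤ} (hv : IsSmoothInt p v) (hw : IsSmoothInt p w)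
    (h : IsSquare (-(v * w) : ZMod p)) : residueClass p v + residueClass p w = 0 := by
  obtain ⟨s, hs⟩ := h
  have hv0 := hv.cast_ne_zero hp.out
  have hw0 := hw.cast_ne_zero hp.out
  have hs0 : s ≠ 0 := fun h => neg_ne_zero.mpr (mul_ne_zero hv0 hw0) (by rw [hs, h, zero_mul])
  have h1 : residueClass p w = residueClass p (-v) :=
    residueClass_eq_of_cast_eq hw hv.neg (t := s / v) (div_ne_zero hs0 hv0) (by
      push_cast
      field_simp
      linear_combination -hs)
  rw [h1, residueClass_neg, add_neg_cancel]

/-- A ternary form over 𝔽_p is isotropic: u x² + v y² = −w is solvable. Replacing u, v by lifts a, b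
of u x², v y² turns [u] + [v] into [a + b] + [ab(a + b)], whose first term cancels [w]. -/
theorem exists_residueClass_add_add (hp2 : p ≠ 2) {u v w : ℤ} (hu : IsSmoothInt p u)
    (hv : IsSmoothInt p v) (hw : IsSmoothInt p w) : ∃ r, IsSmoothInt p r ∧
      residueClass p u + residueClass p v + residueClass p w = residueClass p r := by
  have hu0 := hu.cast_ne_zero hp.out
  have hv0 := hv.cast_ne_zero hp.out
  have hw0 := hw.cast_ne_zero hp.out
  obtain ⟨x, y, hxy⟩ := exists_add_sq_eq hp2 hu0 hv0 (-(w : ZMod p))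
  by_cases hx : x = 0
  · have hy : y ≠ 0 := by
      rintro rfl
      simp [hx, hw0] at hxy
    refine ⟨u, hu, ?_⟩
    have : residueClass p (-w) = residueClass p v :=
      residueClass_eq_of_cast_eq hw.neg hv hy (by
        push_cast; rw [← hxy, hx]; ring)
    rw [← this, residueClass_neg]
    abel
  by_cases hy : y = 0
  · refine ⟨v, hv, ?_⟩
    have : residueClass p (-w) = residueClass p u :=
      residueClass_eq_of_cast_eq hw.neg hu hx (by
        push_cast; rw [← hxy, hy]; ring)
    rw [← this, residueClass_neg]
    abel
  obtain ⟨a, ha⟩ : ∃ a : ℤ, a = ((((u : ZMod p) * x ^ 2).val : ℕ) : ℤ) := ⟨_, rfl⟩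
  -- Taking a in (0, p) but b in (−p, 0) keeps |a + b| below p, so a + b is smooth as well.
  obtain ⟨b, hb⟩ : ∃ b : ℤ, b = ((((v : ZMod p) * y ^ 2).val : ℕ) : ℤ) - p := ⟨_, rfl⟩
  have hac : (a : ZMod p) = u * x ^ 2 := by
    rw [ha, Int.cast_natCast, ZMod.natCast_zmod_val]
  have hbc : (b : ZMod p) = v * y ^ 2 := by
    rw [hb, Int.cast_sub, Int.cast_natCast, ZMod.natCast_zmod_val, Int.cast_natCast,
      ZMod.natCast_self, sub_zero]
  have hac0 : (a : ZMod p) ≠ 0 := by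
    rw [hac]; exact mul_ne_zero hu0 (pow_ne_zero _ hx)
  have hbc0 : (b : ZMod p) ≠ 0 := by
    rw [hbc]; exact mul_ne_zero hv0 (pow_ne_zero _ hy)
  have habc : ((a + b : ℤ) : ZMod p) = -w := by
    rw [Int.cast_add, hac, hbc, hxy]
  have hne : ∀ {z : ℤ}, (z : ZMod p) ≠ 0 → z ≠ 0 := fun h h' => h (by rw [h', Int.cast_zero])
  have ha0 := hne hac0
  have hb0 := hne hbc0
  have hab0 : a + b ≠ 0 := hne (by rw [habc]; exact neg_ne_zero.mpr hw0)
  have hav := ((u : ZMod p) * x ^ 2).val_lt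
  have hbv := ((v : ZMod p) * y ^ 2).val_lt
  have hbv0 : ((v : ZMod p) * y ^ 2).val ≠ 0 := (ZMod.val_eq_zero _).not.mpr (hbc ▸ hbc0)
  have has : IsSmoothInt p a := IsSmoothInt.of_abs_lt ha0 (by rw [abs_lt]; omega)
  have hbs : IsSmoothInt p b := IsSmoothInt.of_abs_lt hb0 (by rw [abs_lt]; omega)
  have habs : IsSmoothInt p (a + b) := IsSmoothInt.of_abs_lt hab0 (by rw [abs_lt]; omega)
  refine ⟨a * b * (a + b), (has.mul hbs).mul habs, ?_⟩
  have e1 := residueClass_eq_of_cast_eq has hu hx hac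
  have e2 := residueClass_eq_of_cast_eq hbs hv hy hbc
  have e3 : residueClass p (a + b) = residueClass p (-w) :=
    residueClass_eq_of_cast_eq habs hw.neg one_ne_zero (by rw [habc]; push_cast; ring)
  rw [← e1, ← e2, residueClass_add hab0, e3, residueClass_neg]
  abel

theorem add_residueClass_mem (hp2 : p ≠ 2) {x : WittGroup ⧸ smoothSubgroup p}
    (hx : x ∈ anisotropicResidues p) {w : ℤ} (hw : IsSmoothInt p w) :
    x + residueClass p w ∈ anisotropicResidues p := by
  rcases hx with rfl | ⟨v, hv, rfl⟩ | ⟨u, v, hu, hv, -, rfl⟩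
  · exact Or.inr (Or.inl ⟨w, hw, zero_add _⟩)
  · by_cases h : IsSquare (-(v * w) : ZMod p)
    · exact Or.inl (residueClass_add_eq_zero hv hw h)
    · exact Or.inr (Or.inr ⟨v, w, hv, hw, h, rfl⟩)
  · exact Or.inr (Or.inl (exists_residueClass_add_add hp2 hu hv hw))

/-- For a generator ⟨pᵉw⟩ only the parity of e matters: it is trivial in the quotient for even e and
the class of w for odd e. Sums are shortened by splitting off hyperbolic planes until the rank is at
most 2. -/
theorem mk_mem_anisotropicResidues (hp2 : p ≠ 2) {x : WittGroup} (hx : x ∈ smoothSubgroup (p + 1)) :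
    (QuotientAddGroup.mk x : WittGroup ⧸ smoothSubgroup p) ∈ anisotropicResidues p := by
  have hp0 : (p : ℚ) ≠ 0 := Nat.cast_ne_zero.mpr hp.out.ne_zero
  induction hx using AddSubgroup.closure_induction with
  | mem x hx =>
    obtain ⟨m, hm, rfl⟩ := hx
    obtain ⟨e, w, hw, rfl⟩ := hm.exists_eq_pow_mul hp.out
    rcases Nat.even_or_odd' e with ⟨k, rfl | rfl⟩
    · left
      rw [QuotientAddGroup.eq_zero_iff]
      have : ((p ^ (2 * k) * w : ℤ) : ℚ) = w * (p ^ k) ^ 2 := by push_cast; ring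
      rw [this, unary_mul_sq _ (pow_ne_zero _ hp0)]
      exact unary_mem_smoothSubgroup hw
    · right; left
      refine ⟨w, hw, ?_⟩
      have : ((p ^ (2 * k + 1) * w : ℤ) : ℚ) = ((p * w : ℤ) : ℚ) * (p ^ k) ^ 2 := by
        push_cast; ring
      rw [this, unary_mul_sq _ (pow_ne_zero _ hp0), residueClass]
  | zero => exact Or.inl rfl
  | add x y _ _ ihx ihy =>
    rw [QuotientAddGroup.mk_add]
    rcases ihy with h | ⟨v, hv, h⟩ | ⟨u, v, hu, hv, -, h⟩
    · rwa [h, add_zero]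
    · rw [h]
      exact add_residueClass_mem hp2 ihx hv
    · rw [h, ← add_assoc]
      exact add_residueClass_mem hp2 (add_residueClass_mem hp2 ihx hu) hv
  | neg x _ ih =>
    rw [QuotientAddGroup.mk_neg]
    rcases ih with h | ⟨v, hv, h⟩ | ⟨u, v, hu, hv, huv, h⟩
    · exact Or.inl (by rw [h, neg_zero])
    · exact Or.inr (Or.inl ⟨-v, hv.neg, by rw [h, residueClass_neg]⟩)
    · refine Or.inr (Or.inr ⟨-u, -v, hu.neg, hv.neg, ?_, ?_⟩)
      · push_cast
        rwa [neg_mul_neg]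
      · rw [h, residueClass_neg, residueClass_neg, neg_add]

end Prime

/-! ## Integral forms unimodular at a prime -/

/-- The classes of integral forms whose determinant is not divisible by `p`. -/
def unimodularAt (p : ℕ) (hp : p.Prime) : AddSubgroup WittGroup where
  carrier := {x | ∃ (ι : Type) (_ : Fintype ι) (_ : DecidableEq ι) (G : Matrix ι ι ℤ), G.IsSymm ∧
    ¬ (p : ℤ) ∣ G.det ∧ x = ofMatrix (G.map (Int.castRingHom ℚ))}
  zero_mem' := ⟨Fin 0, inferInstance, inferInstance, 0, by simp, by
    rw [det_isEmpty]
    exact fun h => hp.one_lt.ne' (by exact_mod_cast Int.eq_one_of_dvd_one (by positivity) h),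
    (ofMatrix_of_isEmpty _).symm⟩
  add_mem' := by
    rintro _ _ ⟨ι, _, _, G, hG, hGp, rfl⟩ ⟨κ, _, _, H, hH, hHp, rfl⟩
    have hdet : ∀ {μ : Type} [Fintype μ] [DecidableEq μ] {M : Matrix μ μ ℤ}, ¬ (p : ℤ) ∣ M.det →
        (M.map (Int.castRingHom ℚ)).det ≠ 0 := by
      intro μ _ _ M hM h
      rw [← RingHom.mapMatrix_apply, ← RingHom.map_det, eq_intCast, Int.cast_eq_zero] at h
      exact hM (h ▸ dvd_zero _)
    refine ⟨ι ⊕ κ, inferInstance, inferInstance, fromBlocks G 0 0 H,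
      fromBlocks_diagonal_isSymm hG hH, ?_, ?_⟩
    · rw [det_fromBlocks_zero₂₁]
      exact fun h => ((Nat.prime_iff_prime_int.mp hp).dvd_or_dvd h).elim hGp hHp
    · rw [fromBlocks_map, Matrix.map_zero _ (map_zero _), Matrix.map_zero _ (map_zero _),
        ofMatrix_fromBlocks (hG.map _) (hdet hGp) (hH.map _) (hdet hHp)]
  neg_mem' := by
    rintro _ ⟨ι, _, _, G, hG, hGp, rfl⟩
    refine ⟨ι, inferInstance, inferInstance, -G, hG.neg, ?_, ?_⟩
    · rw [det_neg]
      intro h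
      refine hGp ?_
      rcases neg_one_pow_eq_or ℤ (Fintype.card ι) with h1 | h1 <;> rw [h1] at h <;> simpa using h
    · rw [← ofMatrix_neg]
      congr 1

theorem smoothSubgroup_le_unimodularAt {p : ℕ} (hp : p.Prime) :
    smoothSubgroup p ≤ unimodularAt p hp := by
  rw [smoothSubgroup, AddSubgroup.closure_le]
  rintro _ ⟨a, ha, rfl⟩
  refine ⟨Unit, inferInstance, inferInstance, diagonal fun _ => a, isSymm_diagonal _, ?_, ?_⟩
  · simpa using ha.not_dvd hp
  · rw [unary, diagonal_map (map_zero _)]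
    rfl

/-- If the sum has the class of G, then G ⊕ p·diag(−w) is metabolic, and
`exists_isotropic_of_isMetabolic` applies. -/
theorem exists_sum_eq_zero_of_mem_unimodularAt {p : ℕ} [hp : Fact p.Prime] {κ : Type} [Fintype κ]
    [DecidableEq κ] [Nonempty κ] {w : κ → ℤ} (hw : ∀ i, w i ≠ 0)
    (h : ∑ i, unary (p * w i : ℤ) ∈ unimodularAt p hp.out) :
    ∃ z : κ → ZMod p, z ≠ 0 ∧ ∑ i, (w i : ZMod p) * z i ^ 2 = 0 := by
  have hpw : ∀ i, ((p * w i : ℤ) : ℚ) ≠ 0 := fun i => Int.cast_ne_zero.mpr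
    (mul_ne_zero (Int.natCast_ne_zero.mpr hp.out.ne_zero) (hw i))
  obtain ⟨ι, _, _, G, hG, hGp, hsum⟩ := h
  have hW : (((p : ℤ) • (-diagonal w)).map (Int.castRingHom ℚ)) =
      -diagonal fun i => ((p * w i : ℤ) : ℚ) := by
    ext i j
    rw [map_apply, Matrix.smul_apply, Matrix.neg_apply, Matrix.neg_apply, diagonal_apply,
      diagonal_apply]
    split_ifs <;> simp
  have hGdet : (G.map (Int.castRingHom ℚ)).det ≠ 0 := by
    rw [← RingHom.mapMatrix_apply, ← RingHom.map_det, eq_intCast, Int.cast_ne_zero]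
    exact fun h => hGp (h ▸ dvd_zero _)
  have hdsymm : (-diagonal fun i => ((p * w i : ℤ) : ℚ)).IsSymm := (isSymm_diagonal _).neg
  have hddet : (-diagonal fun i => ((p * w i : ℤ) : ℚ)).det ≠ 0 := by
    rw [det_neg, det_diagonal]
    exact mul_ne_zero (pow_ne_zero _ (by simp)) (Finset.prod_ne_zero_iff.mpr fun i _ => hpw i)
  obtain ⟨z, hz, hz'⟩ := exists_isotropic_of_isMetabolic (p := p) (G := G) (W := -diagonal w) hG hGp
    (isSymm_diagonal _).neg (by
      rw [hW]
      refine isMetabolic_of_ofMatrix_eq_zero (fromBlocks_diagonal_isSymm (hG.map _) hdsymm)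
        (by rw [det_fromBlocks_zero₂₁]; exact mul_ne_zero hGdet hddet) ?_
      rw [ofMatrix_fromBlocks (hG.map _) hGdet hdsymm hddet, ofMatrix_neg, ofMatrix_diagonal hpw,
        ← hsum, add_neg_cancel])
  refine ⟨z, hz, ?_⟩
  have h1 : (-diagonal w).map (Int.castRingHom (ZMod p)) =
      -diagonal fun i => (w i : ZMod p) := by
    ext i j
    by_cases hij : i = j
    · subst hij; simp
    · simp [hij]
  rw [h1, neg_mulVec, dotProduct_neg, neg_eq_zero] at hz'
  rw [← hz']
  simp only [dotProduct, mulVec_diagonal]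
  exact Finset.sum_congr rfl fun i _ => by ring

theorem mem_smoothSubgroup_of_succ {p : ℕ} [hp : Fact p.Prime] (hp2 : p ≠ 2) {x : WittGroup}
    (hx : x ∈ smoothSubgroup (p + 1)) (hxp : x ∈ unimodularAt p hp.out) :
    x ∈ smoothSubgroup p := by
  have hle := smoothSubgroup_le_unimodularAt hp.out
  -- Smooth forms are unimodular at p, so unimodularity at p depends only on the coset. It therefore
  -- passes to the anisotropic representative, which must then be zero.
  have key : ∀ y, (QuotientAddGroup.mk x : WittGroup ⧸ smoothSubgroup p) = QuotientAddGroup.mk y →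
      y ∈ unimodularAt p hp.out := by
    intro y h
    have := AddSubgroup.add_mem _ hxp (hle (QuotientAddGroup.eq.mp h))
    rwa [add_neg_cancel_left] at this
  rcases mk_mem_anisotropicResidues hp2 hx with h | ⟨w, hw, h⟩ | ⟨v, w, hv, hw, hvw, h⟩
  · exact (QuotientAddGroup.eq_zero_iff x).mp h
  · exfalso
    obtain ⟨z, hz, hz'⟩ := exists_sum_eq_zero_of_mem_unimodularAt (p := p) (κ := Unit)
      (w := fun _ => w) (fun _ => hw.ne_zero) (by simpa using key _ h)
    simp only [Finset.univ_unique, Finset.sum_singleton, mul_eq_zero, hw.cast_ne_zero hp.out,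
      false_or, pow_eq_zero_iff two_ne_zero] at hz'
    exact hz (funext fun _ => hz')
  · exfalso
    obtain ⟨z, hz, hz'⟩ := exists_sum_eq_zero_of_mem_unimodularAt (p := p) (κ := Fin 2)
      (w := ![v, w]) (fun i => by fin_cases i; exacts [hv.ne_zero, hw.ne_zero])
      (by simpa using key _ h)
    simp only [Fin.sum_univ_two, cons_val_zero, cons_val_one] at hz'
    have hw0 := hw.cast_ne_zero hp.out
    by_cases h0 : z 0 = 0
    · refine hz (funext fun i => ?_)
      have h1 : z 1 = 0 := by simpa [h0, hw0] using hz'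
      fin_cases i
      exacts [h0, h1]
    · refine hvw ⟨w * z 1 / z 0, ?_⟩
      field_simp
      linear_combination -hz'

/-- A form that is unimodular at all odd primes is a sum of forms `⟨± 1⟩` and `⟨± 2⟩`. -/
theorem exists_eq_zsmul_add_zsmul {x : WittGroup}
    (hx : ∀ p (hp : p.Prime), p ≠ 2 → x ∈ unimodularAt p hp) :
    ∃ a b : ℤ, x = a • unary 1 + b • unary 2 := by
  obtain ⟨k, hk, hxk⟩ := exists_mem_smoothSubgroup x
  have h3 : x ∈ smoothSubgroup 3 := by
    -- Descent from k + 1 to k: nothing changes when k is composite, and an odd prime k is removed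
    -- by unimodularity.
    induction k, hk using Nat.le_induction with
    | base => exact hxk
    | succ k hk ih =>
      by_cases hkp : k.Prime
      · have : Fact k.Prime := ⟨hkp⟩
        exact ih (mem_smoothSubgroup_of_succ (by omega) hxk (hx k hkp (by omega)))
      · refine ih ?_
        simpa only [smoothSubgroup, IsSmoothInt, Nat.smoothNumbers_succ hkp] using hxk
  suffices h : smoothSubgroup 3 ≤ AddSubgroup.closure {unary 1, unary 2} by
    obtain ⟨a, b, hab⟩ := AddSubgroup.mem_closure_pair.mp (h h3)
    exact ⟨a, b, hab.symm⟩
  have m1 : unary 1 ∈ AddSubgroup.closure {unary 1, unary 2} :=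
    AddSubgroup.subset_closure (by simp)
  have m2 : unary 2 ∈ AddSubgroup.closure {unary 1, unary 2} :=
    AddSubgroup.subset_closure (by simp)
  rw [smoothSubgroup, AddSubgroup.closure_le]
  rintro _ ⟨m, hm, rfl⟩
  obtain ⟨e, w, hw, rfl⟩ := IsSmoothInt.exists_eq_pow_mul Nat.prime_two hm
  have hw1 : w = 1 ∨ w = -1 := by
    have h : w.natAbs ∈ Nat.smoothNumbers 2 := hw
    rw [Nat.smoothNumbers_succ (by norm_num), Nat.smoothNumbers_one] at h
    exact Int.natAbs_eq_natAbs_iff.mp (by simpa using h)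
  have hpow : ∀ k : ℕ, ((2 : ℚ) ^ k) ≠ 0 := fun k => by positivity
  rcases Nat.even_or_odd' e with ⟨k, rfl | rfl⟩
  · have e1 : (((2 : ℕ) ^ (2 * k) * w : ℤ) : ℚ) = w * (2 ^ k) ^ 2 := by push_cast; ring
    rw [e1, unary_mul_sq _ (hpow k)]
    rcases hw1 with rfl | rfl
    · simpa using m1
    · simpa [unary_neg] using m1
  · have e1 : (((2 : ℕ) ^ (2 * k + 1) * w : ℤ) : ℚ) = (w * 2) * (2 ^ k) ^ 2 := by push_cast; ring
    rw [e1, unary_mul_sq _ (hpow k)]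
    rcases hw1 with rfl | rfl
    · simpa using m2
    · simpa [unary_neg] using m2

end WittGroup

end

/-! ## Bordered forms -/

section Bordered

variable {ι : Type*} [Fintype ι] [DecidableEq ι]

/-- The matrix `A` bordered by the vector `v` and the number `q`. -/
def borderedMatrix {R : Type*} [Zero R] (A : Matrix ι ι R) (v : ι → R) (q : R) :
    Matrix (ι ⊕ Unit) (ι ⊕ Unit) R :=
  fromBlocks A (replicateCol Unit v) (replicateRow Unit v) (diagonal fun _ => q)

theorem borderedMatrix_isSymm {ι R : Type*} [CommRing R] {A : Matrix ι ι R} (hA : A.IsSymm)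
    (v : ι → R) (q : R) : (borderedMatrix A v q).IsSymm := by
  rw [IsSymm, borderedMatrix, fromBlocks_transpose, hA.eq, diagonal_transpose,
    transpose_replicateCol, transpose_replicateRow]

theorem borderedMatrix_map {ι R S : Type*} [CommRing R] [CommRing S] (f : R →+* S) (A : Matrix ι ι R)
    (v : ι → R) (q : R) :
    (borderedMatrix A v q).map f = borderedMatrix (A.map f) (f ∘ v) (f q) := by
  rw [borderedMatrix, borderedMatrix, fromBlocks_map, diagonal_map (map_zero f)]
  rfl

/-- Completing the square: the shear by A⁻¹v clears the border and leaves the Schur complement in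
the corner. -/
theorem borderedMatrix_eq {A : Matrix ι ι ℚ} (hA : A.IsSymm) (hdet : A.det ≠ 0) (v : ι → ℚ)
    (q : ℚ) :
    (fromBlocks 1 (replicateCol Unit (A⁻¹ *ᵥ v)) 0 1)ᵀ *
      fromBlocks A 0 0 (diagonal fun _ : Unit => q - v ⬝ᵥ A⁻¹ *ᵥ v) *
      fromBlocks 1 (replicateCol Unit (A⁻¹ *ᵥ v)) 0 1 = borderedMatrix A v q := by
  have hunit : IsUnit A.det := hdet.isUnit
  have h1 : A * replicateCol Unit (A⁻¹ *ᵥ v) = replicateCol Unit v := by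
    rw [← replicateCol_mulVec, mulVec_mulVec, mul_nonsing_inv _ hunit, one_mulVec]
  have h2 : replicateRow Unit (A⁻¹ *ᵥ v) * A = replicateRow Unit v := by
    rw [← transpose_inj, transpose_mul, transpose_replicateRow, transpose_replicateRow, hA.eq, h1]
  rw [fromBlocks_transpose, fromBlocks_multiply, fromBlocks_multiply, borderedMatrix]
  simp only [transpose_one, transpose_zero, Matrix.one_mul, Matrix.mul_one, Matrix.zero_mul,
    Matrix.mul_zero, add_zero, zero_add, transpose_replicateCol, h1, h2]
  congr 1
  ext i j
  simp [Matrix.mul_apply, dotProduct]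

theorem det_borderedMatrix {A : Matrix ι ι ℚ} (hA : A.IsSymm) (hdet : A.det ≠ 0) (v : ι → ℚ)
    (q : ℚ) : (borderedMatrix A v q).det = A.det * (q - v ⬝ᵥ A⁻¹ *ᵥ v) := by
  rw [← borderedMatrix_eq hA hdet, det_mul, det_mul, det_transpose, det_fromBlocks_zero₂₁,
    det_fromBlocks_zero₂₁]
  simp

theorem congruent_borderedMatrix {A : Matrix ι ι ℚ} (hA : A.IsSymm) (hdet : A.det ≠ 0)
    (v : ι → ℚ) (q : ℚ) :
    MatCongruent (fromBlocks A 0 0 (diagonal fun _ : Unit => q - v ⬝ᵥ A⁻¹ *ᵥ v))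
      (borderedMatrix A v q) := by
  refine ⟨_, fromBlocks 1 (-replicateCol Unit (A⁻¹ *ᵥ v)) 0 1, ?_, ?_,
    borderedMatrix_eq hA hdet v q⟩ <;>
  simp [fromBlocks_multiply]

end Bordered

namespace WittGroup

theorem signature_ofMatrix_eq_matrixSignature {m : ℕ} {A : Matrix (Fin m) (Fin m) ℤ}
    (hA : A.IsSymm) (hdet : (A.map (Int.castRingHom ℚ)).det ≠ 0) :
    signature (ofMatrix (A.map (Int.castRingHom ℚ))) = matrixSignature A := by
  obtain ⟨d, hd⟩ := exists_congruent_diagonal (hA.map (Int.castRingHom ℚ))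
  have h := hd.det_ne_zero hdet
  rw [det_diagonal] at h
  rw [matrixSignature_of_congruent_diagonal hd, ofMatrix_congr hd, signature_ofMatrix_diagonal
    fun i => Finset.prod_ne_zero_iff.mp h i (Finset.mem_univ i)]

theorem unary_two_add_unary_two : unary 2 + unary 2 = unary 1 + unary 1 := by
  rw [unary_add_unary (by norm_num)]
  have h1 : unary (2 + 2) = unary 1 := by
    rw [← unary_mul_sq 1 (two_ne_zero)]; norm_num
  have h2 : unary (2 * 2 * (2 + 2)) = unary 1 := by
    rw [← unary_mul_sq 1 (four_ne_zero)]; norm_num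
  rw [h1, h2]

/-- An integral form of determinant `± 2` and signature `ε = ± 1` is Witt equivalent to `⟨2 ε⟩`. -/
theorem ofMatrix_eq_unary_of_abs_det_eq_two {ι : Type} [Fintype ι] [DecidableEq ι]
    {G : Matrix ι ι ℤ} (hG : G.IsSymm) (hdet : |G.det| = 2) {ε : ℤ} (hε : ε = 1 ∨ ε = -1)
    (hsig : signature (ofMatrix (G.map (Int.castRingHom ℚ))) = ε) :
    ofMatrix (G.map (Int.castRingHom ℚ)) = unary (2 * ε) := by
  have hdetQ : |(G.map (Int.castRingHom ℚ)).det| = 2 := by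
    rw [← RingHom.mapMatrix_apply, ← RingHom.map_det, eq_intCast, ← Int.cast_abs, hdet]
    norm_num
  have hdet0 : (G.map (Int.castRingHom ℚ)).det ≠ 0 := fun h => by
    rw [h, abs_zero] at hdetQ; norm_num at hdetQ
  have hε0 : (ε : ℚ) ≠ 0 := by rcases hε with rfl | rfl <;> norm_num
  have hunary : unary ε = ε • unary 1 := by
    rcases hε with rfl | rfl
    · simp
    · simp [unary_neg]
  have hunary2 : unary (2 * ε) = ε • unary 2 := by
    rcases hε with rfl | rfl
    · simp
    · simp [unary_neg]
  obtain ⟨a, b, hab⟩ := exists_eq_zsmul_add_zsmul (x := ofMatrix (G.map (Int.castRingHom ℚ)))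
    fun p hp hp2 => ⟨ι, inferInstance, inferInstance, G, hG, fun h => by
      rw [← dvd_abs, hdet] at h
      exact hp2 ((Nat.prime_dvd_prime_iff_eq hp Nat.prime_two).mp (by exact_mod_cast h)), rfl⟩
  -- Both ⟨1⟩ and ⟨2⟩ have signature 1.
  have hsum : a + b = ε := by
    rw [hab, map_add, map_zsmul, map_zsmul, signature_unary, signature_unary] at hsig
    simpa using hsig
  have h22 : ∀ c : ℤ, (2 * c) • unary 2 = (2 * c) • unary 1 := fun c => by
    rw [mul_comm, mul_zsmul, mul_zsmul, two_zsmul, two_zsmul, unary_two_add_unary_two]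
  rcases Int.even_or_odd' b with ⟨c, rfl | rfl⟩
  -- For even b the class is ⟨ε⟩, so G ⊕ ⟨−ε⟩ would be metabolic; its determinant is 2 in absolute
  -- value, which is not a rational square.
  · exfalso
    rw [h22, ← add_zsmul, hsum, ← hunary] at hab
    have hd : (-diagonal fun _ : Unit => (ε : ℚ)).det ≠ 0 := by
      simpa [det_neg] using hε0
    have hs : (-diagonal fun _ : Unit => (ε : ℚ)).IsSymm := (isSymm_diagonal _).neg
    have hmet : IsMetabolic (fromBlocks (G.map (Int.castRingHom ℚ)) 0 0
        (-diagonal fun _ : Unit => (ε : ℚ))) := by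
      refine isMetabolic_of_ofMatrix_eq_zero (fromBlocks_diagonal_isSymm (hG.map _) hs)
        (by rw [det_fromBlocks_zero₂₁]; exact mul_ne_zero hdet0 hd) ?_
      rw [ofMatrix_fromBlocks (hG.map _) hdet0 hs hd, ofMatrix_neg, hab]
      exact add_neg_cancel _
    obtain ⟨c, hc⟩ := hmet.exists_abs_det_eq_sq (fromBlocks_diagonal_isSymm (hG.map _) hs)
      (by rw [det_fromBlocks_zero₂₁]; exact mul_ne_zero hdet0 hd)
    have h1 : |(-diagonal fun _ : Unit => (ε : ℚ)).det| = 1 := by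
      rcases hε with rfl | rfl <;> simp
    rw [det_fromBlocks_zero₂₁, abs_mul, hdetQ, h1, mul_one] at hc
    refine irrational_sqrt_two ⟨|c|, ?_⟩
    have hcR : (2 : ℝ) = (|c| : ℚ) ^ 2 := by
      rw [← Rat.cast_pow, sq_abs, ← hc]; norm_num
    rw [hcR, Real.sqrt_sq (by positivity)]
  · have ha : a = ε - 1 - 2 * c := by linarith
    -- For odd b the coefficient of ⟨1⟩ is even because ε is odd, so it can be moved entirely to
    -- ⟨2⟩.
    obtain ⟨e, he⟩ : ∃ e, ε - 1 = 2 * e := by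
      rcases hε with rfl | rfl
      · exact ⟨0, rfl⟩
      · exact ⟨-1, rfl⟩
    rw [hab, hunary2, ha, he, ← mul_sub, ← h22, ← add_zsmul]
    congr 1
    linarith

end WittGroup

/-! ## The form of a Seifert matrix -/

theorem exists_sum_eq_and_prod_eq {ι : Type*} (s : Finset ι) {f : ι → ℤ}
    (hf : ∀ i ∈ s, f i = 1 ∨ f i = -1) :
    ∃ k : ℕ, ∑ i ∈ s, f i = s.card - 2 * k ∧ ∏ i ∈ s, f i = (-1) ^ k := by
  classical
  induction s using Finset.induction_on with
  | empty => exact ⟨0, by simp⟩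
  | insert i s hi ih =>
    obtain ⟨k, h1, h2⟩ := ih fun j hj => hf j (Finset.mem_insert_of_mem hj)
    rw [Finset.sum_insert hi, Finset.prod_insert hi, Finset.card_insert_of_notMem hi, h1, h2]
    rcases hf i (Finset.mem_insert_self i s) with h | h
    · exact ⟨k, by rw [h]; push_cast; ring, by rw [h, one_mul]⟩
    · exact ⟨k + 1, by rw [h]; push_cast; ring, by rw [h, pow_succ']⟩

/-- The signature of a non-singular form determines the sign of its determinant. -/
theorem exists_matrixSignature_eq {m : ℕ} {A : Matrix (Fin m) (Fin m) ℤ} (hA : A.IsSymm)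
    (hdet : A.det ≠ 0) : ∃ k : ℕ, matrixSignature A = m - 2 * k ∧
      (SignType.sign A.det : ℤ) = (-1) ^ k := by
  obtain ⟨d, hd⟩ := exists_congruent_diagonal (hA.map (Int.castRingHom ℚ))
  obtain ⟨c, hc, h⟩ := hd.exists_det_eq
  rw [← RingHom.mapMatrix_apply, ← RingHom.map_det, eq_intCast, det_diagonal] at h
  have h0 : ∏ i, d i ≠ 0 := by
    rw [h]; exact mul_ne_zero (pow_ne_zero _ hc) (Int.cast_ne_zero.mpr hdet)
  obtain ⟨k, h1, h2⟩ := exists_sum_eq_and_prod_eq Finset.univ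
    (f := fun i => (SignType.sign (d i) : ℤ)) fun i hi => by
      rcases lt_or_gt_of_ne (Finset.prod_ne_zero_iff.mp h0 i hi) with h | h <;> simp [h]
  refine ⟨k, ?_, ?_⟩
  · rw [matrixSignature_of_congruent_diagonal hd, h1, Finset.card_univ, Fintype.card_fin]
  · rw [← h2]
    have h3 : SignType.sign (∏ i, d i) = SignType.sign A.det := by
      rw [h, sign_mul, sign_pos (by positivity), one_mul]
      rcases lt_trichotomy A.det 0 with h | h | h <;> simp [h]
    rw [← h3]
    have h4 := map_prod (SignType.castHom (α := ℤ).toMonoidHom.comp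
      (signHom (α := ℚ)).toMonoidHom) d Finset.univ
    exact h4

/-- The order N of the generator kills the whole group, so N eᵢ lies in the image of V + Vᵗ. A
vector u in the left kernel is orthogonal to this image, whence N uᵢ = 0 for every i. -/
theorem det_ne_zero_of_hasLinkingGenerator {m : ℕ} {V : Matrix (Fin m) (Fin m) ℤ} {q : ℚ}
    (h : HasLinkingGenerator V q) : (V + Vᵀ).det ≠ 0 := by
  obtain ⟨h, htors, hgen, -⟩ := h
  obtain ⟨N, hN, hNh⟩ := isOfFinAddOrder_iff_nsmul_eq_zero.mp htors
  intro hdet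
  obtain ⟨u, hu, hu'⟩ := Matrix.exists_vecMul_eq_zero_iff.mpr hdet
  refine hu (funext fun i => ?_)
  have h1 : N • (Submodule.Quotient.mk (Pi.single i 1) : BranchedCoverHomology V) = 0 := by
    obtain ⟨k, hk⟩ := AddSubgroup.mem_zmultiples_iff.mp
      (hgen.ge (AddSubgroup.mem_top (Submodule.Quotient.mk (Pi.single i 1))))
    rw [← hk, smul_comm, hNh, smul_zero]
  rw [← Submodule.Quotient.mk_smul, Submodule.Quotient.mk_eq_zero] at h1
  obtain ⟨y, hy⟩ := h1
  have h2 : u ⬝ᵥ (V + Vᵀ) *ᵥ y = u ⬝ᵥ (N • Pi.single i 1) := by rw [← hy]; rfl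
  rw [dotProduct_mulVec, hu', zero_dotProduct, dotProduct_smul, dotProduct_single, mul_one] at h2
  have := smul_eq_zero.mp h2.symm
  exact this.resolve_left hN.ne'

theorem exists_int_of_hasLinkingGenerator {m : ℕ} {V : Matrix (Fin m) (Fin m) ℤ} {r : ℚ}
    (h : HasLinkingGenerator V r) : ∃ (v : Fin m → ℤ) (q : ℤ),
      (q : ℚ) = (Int.castRingHom ℚ ∘ v) ⬝ᵥ (symmetrization V)⁻¹ *ᵥ (Int.castRingHom ℚ ∘ v) - r := by
  obtain ⟨h, -, -, hl⟩ := h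
  obtain ⟨v, rfl⟩ := Submodule.Quotient.mk_surjective _ h
  rw [linkingPairing_mk, ← sub_eq_zero, ← AddCircle.coe_sub, AddCircle.coe_eq_zero_iff] at hl
  obtain ⟨q, hq⟩ := hl
  refine ⟨v, q, ?_⟩
  rw [zsmul_eq_mul, mul_one] at hq
  exact hq

theorem theorem4p7 (K : Knot) (n : ℕ) (V : Matrix (Fin (2 * n)) (Fin (2 * n)) ℤ)
    (hV : IsSeifertMatrix K V) (ε : ℤ) (hε : ε = 1 ∨ ε = -1)
    (hσ : knotSignature V = 0 ∨ knotSignature V = 2 * ε)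
    (hl : HasLinkingGenerator V (-2 * (ε : ℚ) / (knotDet V : ℚ))) :
    ∃ (hdet : (symmetrization V).det ≠ 0)
      (hdiag : (diagonal ![2 * (ε : ℚ), -2 * (ε : ℚ) * (knotDet V : ℚ)]).det ≠ 0),
      wittClass V hdet =
        WittGroup.mk (diagonal ![2 * (ε : ℚ), -2 * (ε : ℚ) * (knotDet V : ℚ)])
          (isSymm_diagonal _) hdiag := by
  have hAdet := det_ne_zero_of_hasLinkingGenerator hl
  have hA : (V + Vᵀ).IsSymm := by
    rw [IsSymm, transpose_add, transpose_transpose, add_comm]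
  have hS : symmetrization V = (V + Vᵀ).map (Int.castRingHom ℚ) := rfl
  have hSsymm := symmetrization_isSymm V
  have hSdet' : (symmetrization V).det = ((V + Vᵀ).det : ℚ) := by
    rw [hS, ← RingHom.mapMatrix_apply, ← RingHom.map_det, eq_intCast]
  have hSdet : (symmetrization V).det ≠ 0 := by
    rw [hSdet']; exact Int.cast_ne_zero.mpr hAdet
  have hε0 : (ε : ℚ) ≠ 0 := by rcases hε with rfl | rfl <;> norm_num
  have hεsign : (SignType.sign (ε : ℚ) : ℤ) = ε := by rcases hε with rfl | rfl <;> simp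
  set D := knotDet V with hD
  have hD0 : (D : ℚ) ≠ 0 := by
    rw [hD, knotDet]
    exact Int.cast_ne_zero.mpr (mul_ne_zero (pow_ne_zero _ (by norm_num)) hAdet)
  obtain ⟨v, q, hq⟩ := exists_int_of_hasLinkingGenerator hl
  have hq' : (q : ℚ) - (Int.castRingHom ℚ ∘ v) ⬝ᵥ (symmetrization V)⁻¹ *ᵥ (Int.castRingHom ℚ ∘ v) =
      2 * ε / D := by
    rw [hq]; ring
  -- Scaling by the square D² replaces 1/D by D.
  have hunary : WittGroup.unary (2 * ε / D) = WittGroup.unary (2 * ε * D) := by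
    rw [← WittGroup.unary_mul_sq (2 * ε / D : ℚ) hD0]
    congr 1
    field_simp
  set U := borderedMatrix (V + Vᵀ) v q with hU
  have hUmap : U.map (Int.castRingHom ℚ) =
      borderedMatrix (symmetrization V) (Int.castRingHom ℚ ∘ v) q := borderedMatrix_map _ _ _ _
  have hUdet : |U.det| = 2 := by
    have h1 : (U.det : ℚ) = (-1) ^ n * (2 * ε) := by
      rw [← eq_intCast (Int.castRingHom ℚ), RingHom.map_det, RingHom.mapMatrix_apply, hUmap,
        det_borderedMatrix hSsymm hSdet, hq', hD, knotDet, hSdet']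
      have h2 : ((V + Vᵀ).det : ℚ) ≠ 0 := Int.cast_ne_zero.mpr hAdet
      generalize (V + Vᵀ).det = δ at h2 ⊢
      push_cast
      rcases neg_one_pow_eq_or ℚ n with h | h <;> rw [h] <;> field_simp
    have h2 : U.det = (-1) ^ n * (2 * ε) := by exact_mod_cast h1
    rw [h2, abs_mul, abs_pow, abs_neg, abs_one, one_pow, one_mul]
    rcases hε with rfl | rfl <;> rfl
  have hclass : WittGroup.ofMatrix (U.map (Int.castRingHom ℚ)) =
      WittGroup.ofMatrix (symmetrization V) + WittGroup.unary (2 * ε * D) := by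
    have h2 : (2 * ε / D : ℚ) ≠ 0 := div_ne_zero (mul_ne_zero two_ne_zero hε0) hD0
    rw [hUmap, ← WittGroup.ofMatrix_congr (congruent_borderedMatrix hSsymm hSdet _ _), hq',
      WittGroup.ofMatrix_fromBlocks hSsymm hSdet (isSymm_diagonal _) (by simpa using h2), ← hunary]
    rfl
  have hsig : WittGroup.signature (WittGroup.ofMatrix (U.map (Int.castRingHom ℚ))) = ε := by
    rw [hclass, map_add, hS, WittGroup.signature_ofMatrix_eq_matrixSignature hA hSdet,
      WittGroup.signature_unary, sign_mul, sign_mul, sign_pos (two_pos : (0 : ℚ) < 2), one_mul]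
    -- Here σ = 2n − 2k and D has sign (−1)ⁿ⁺ᵏ. If σ = 0, then D > 0 and the new summand contributes
    -- ε; if σ = 2ε, then k = n ± 1, so D < 0 and it contributes −ε. Either way the total is ε.
    obtain ⟨k, hk1, hk2⟩ := exists_matrixSignature_eq hA hAdet
    have hDsign : (SignType.sign (D : ℚ) : ℤ) = (-1) ^ n * (-1) ^ k := by
      have h1 : SignType.sign (D : ℚ) = SignType.sign D := by
        rcases lt_trichotomy D 0 with h | h | h <;> simp [h]
      rw [h1, hD, knotDet, sign_mul, SignType.coe_mul, hk2]
      congr 1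
      rcases neg_one_pow_eq_or ℤ n with h | h <;> rw [h] <;> rfl
    rw [SignType.coe_mul, hεsign, hDsign]
    change matrixSignature (V + Vᵀ) = 0 ∨ matrixSignature (V + Vᵀ) = 2 * ε at hσ
    rcases hσ with h | h
    · have : k = n := by rw [h] at hk1; push_cast at hk1; omega
      rw [h, this, ← mul_pow]
      simp
    · have hpar : k + 1 = n ∨ k = n + 1 := by
        rw [h] at hk1; push_cast at hk1; omega
      have hneg : (-1 : ℤ) ^ n * (-1) ^ k = -1 := by
        rw [← pow_add]
        exact Odd.neg_one_pow (by
          rcases hpar with rfl | rfl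
          · exact ⟨k, by ring⟩
          · exact ⟨n, by ring⟩)
      rw [h, hneg]
      ring
  have hfinal := WittGroup.ofMatrix_eq_unary_of_abs_det_eq_two (borderedMatrix_isSymm hA v q) hUdet
    hε hsig
  have hd : ∀ i, (![2 * (ε : ℚ), -2 * (ε : ℚ) * (D : ℚ)]) i ≠ 0 := by
    intro i
    fin_cases i
    · simpa using hε0
    · exact mul_ne_zero (mul_ne_zero (by norm_num) hε0) hD0
  refine ⟨hSdet, ?_, ?_⟩
  · rw [det_diagonal]
    exact Finset.prod_ne_zero_iff.mpr fun i _ => hd i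
  · rw [wittClass, WittGroup.mk_eq_ofMatrix, WittGroup.mk_eq_ofMatrix,
      WittGroup.ofMatrix_diagonal hd, Fin.sum_univ_two]
    simp only [cons_val_zero, cons_val_one]
    rw [neg_mul, neg_mul, WittGroup.unary_neg, ← hfinal, hclass, add_neg_cancel_right]
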